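/- **Setting.** Fix integers $d,T\ge 1$ and $J\ge 0$, the outcome space $\mathcal Y=[0,1]^d$, a feature space $\mathcal X$ (any measurable space), a finite non-empty action set $\mathcal A$ and a finite family $\mathcal N$ of agents. Each agent has a utility $u:\mathcal A\times\mathcal Y\to[0,1]$ and measurable constraint functions $c_1,\dots,c_J:\mathcal A\times\mathcal Y\to[-1,1]$. For every $a$, $u(a,\cdot)$ is linear (that is, $u(a,k_1y_1+k_2y_2)=k_1u(a,y_1)+k_2u(a,y_2)$ whenever $y_1,y_2,k_1y_1+k_2y_2\in\mathcal Y$) and $L$-Lipschitz in the $\ell_\infty$ norm. **Interaction.** In each round $t=1,\dots,T$, given the transcript $\pi^{<t}$ of the triples $(x_s,p_s,y_s)$, $s<t$, the adversary chooses a (possibly random) feature $x_t\in\mathcal X$ and a distribution $Y_t$ on $\mathcal Y$. The forecaster sees $x_t$ and chooses a distribution $\psi_t$ on $\mathcal Y$. Then $p_t\sim\psi_t$ and $y_t\sim Y_t$ are drawn independently of each other given $(\pi^{<t},x_t)$. Forecaster and adversary are given by probability kernels. **Agents.** Every agent runs the elimination algorithm: $\widehat{\mathcal A}_1=\mathcal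 A$; in round $t$ it plays a constrained best response $a_t=\mathrm{CBR}^u_{\widehat{\mathcal A}_t}(p_t)\in\arg\max_{a\in\widehat{\mathcal A}_t}u(a,p_t)$, where each agent breaks ties by an arbitrary fixed measurable rule, depending only on the set and the prediction (its choice on the empty set is arbitrary too); after seeing $y_t$ it sets $\widehat{\mathcal A}_{t+1}=\widehat{\mathcal A}_t\setminus\{a: c_j(a,y_t)>0\text{ for some }j\}$. The agent's benchmark class is $\mathcal A^{\mathbf c}_{1:T}=\{a: c_j(a,y_t)\le 0\text{ for all }t\le T,\ j\le J\}$. For a non-empty $\mathcal B\subseteq\mathcal A$ let $$\mathrm{Reg}_{\mathrm{swap}}(u,\mathcal B)=\max_{\phi:\mathcal A\to\mathcal B}\sum_{t=1}^T\big(u(\phi(a_t),y_t)-u(a_t,y_t)\big),\qquad \mathrm{Reg}_{\mathrm{ext}}(u,\mathcal B)=\max_{a\in\mathcal B}\sum_{t=1}^T\big(u(a,y_t)-u(a_t,y_t)\big).$$ **Forecaster.** Decision-Calibration-Realization is the algorithm Unbiased-Prediction for the events $E_{(u,\mathbf c),a}(\pi^{<t},x_t,p)=\mathbf 1[\mathrm{CBR}^u_{\widehat{\mathcal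 A}_t}(p)=a]$, with $(u,\mathbf c)\in\mathcal N$ and $a\in\mathcal A$. With learning rate $\eta>0$, it forms in round $t$ the distribution $q_t$ over triples (event $E$, coordinate $i\in\{1,\dots,d\}$, sign $\sigma\in\{\pm1\}$), $$q_t(E,i,\sigma)\propto\exp\Big(\tfrac{\eta}{2}\sum_{s<t}\sigma\,\mathbb E_{p\sim\psi_s}\big[E(\pi^{<s},x_s,p)(p^i-y_s^i)\big]\Big),$$ and outputs a distribution $\psi_t$ that minimizes, up to an additive error of at most $1/T$, $$\psi\mapsto\max_{y\in\mathcal Y}\ \mathbb E_{p\sim\psi}\Big[\sum_{E,i,\sigma}q_t(E,i,\sigma)\,\sigma\,E(\pi^{<t},x_t,p)\,(p^i-y^i)\Big]$$ over all Borel probability distributions $\psi$ on $\mathcal Y$. **Claim.** There are a universal constant $K>0$ and a choice of the learning rate $\eta>0$ as a function of $d,|\mathcal A|,|\mathcal N|,T$ alone such that in every setting as above: (i) a forecaster that runs Decision-Calibration-Realization with this $\eta$ exists; (ii) for every such forecaster, every adversary and every $\delta\in(0,1)$, with probability at least $1-\delta$ the following holds simultaneously for all agents of $\mathcal N$ whose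 benchmark class $\mathcal A^{\mathbf c}_{1:T}$ is non-empty: $$\mathrm{Reg}_{\mathrm{swap}}(u,\mathcal A^{\mathbf c}_{1:T})\le K\,L|\mathcal A|\sqrt{T\ln\frac{d|\mathcal A||\mathcal N|T}{\delta}}\quad\text{and}\quad \mathrm{Reg}_{\mathrm{ext}}(u,\mathcal A^{\mathbf c}_{1:T})\le K\,L|\mathcal A|\sqrt{T\ln\frac{d|\mathcal A||\mathcal N|T}{\delta}} .$$ -/

import Mathlib

open MeasureTheory ProbabilityTheory

namespace Omniprediction

/-- The outcome (and prediction) space `[0,1]^d`, with the sup metric and the Borel sigma-algebra. -/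
abbrev Outcome (d : ℕ) : Type := ↥(Set.Icc (0 : Fin d → ℝ) 1)

/-- An agent: a utility function `A × Y → [0,1]` and `J` (measurable) constraint functions
`A × Y → [-1,1]`. -/
structure Agent (A : Type*) (d J : ℕ) where
  utility : A → Outcome d → ℝ
  constraint : Fin J → A → Outcome d → ℝ
  utility_mem : ∀ a y, utility a y ∈ Set.Icc (0 : ℝ) 1
  constraint_mem : ∀ j a y, constraint j a y ∈ Set.Icc (-1 : ℝ) 1
  measurable_constraint : ∀ j a, Measurable (constraint j a)

/-- The utility is linear in the outcome, wherever the linear combination is again an outcome. -/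
def Agent.LinearUtility {A : Type*} {d J : ℕ} (g : Agent A d J) : Prop :=
  ∀ (a : A) (k₁ k₂ : ℝ) (y₁ y₂ y : Outcome d),
    (y : Fin d → ℝ) = k₁ • (y₁ : Fin d → ℝ) + k₂ • (y₂ : Fin d → ℝ) →
      g.utility a y = k₁ * g.utility a y₁ + k₂ * g.utility a y₂

/-- The utility is `L`-Lipschitz in the outcome, for the sup norm (the norm of `Fin d → ℝ`). -/
def Agent.LipschitzUtility {A : Type*} {d J : ℕ} (g : Agent A d J) (L : ℝ) : Prop :=
  ∀ (a : A) (y₁ y₂ : Outcome d),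
    |g.utility a y₁ - g.utility a y₂| ≤ L * ‖(y₁ : Fin d → ℝ) - (y₂ : Fin d → ℝ)‖

/-- One round of the interaction: feature `x`, prediction `p`, outcome `y`. -/
abbrev Round (X : Type*) (d : ℕ) := X × Outcome d × Outcome d

/-- A transcript of `t` rounds. Rounds are numbered from `0`. -/
abbrev Transcript (X : Type*) (d t : ℕ) := Fin t → Round X d

/-- The feature of round `s`. -/
abbrev feature {X : Type*} {d t : ℕ} (h : Transcript X d t) (s : Fin t) : X := (h s).1

/-- The prediction of round `s`. -/
abbrev prediction {X : Type*} {d t : ℕ} (h : Transcript X d t) (s : Fin t) : Outcome d := (h s).2.1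

/-- The outcome of round `s`. -/
abbrev outcome {X : Type*} {d t : ℕ} (h : Transcript X d t) (s : Fin t) : Outcome d := (h s).2.2

/-- The part of a transcript that precedes round `s`. -/
def before {X : Type*} {d t : ℕ} (h : Transcript X d t) (s : Fin t) : Transcript X d s :=
  fun r => h (Fin.castLE s.isLt.le r)

section Agents

variable {X A : Type*} {d J : ℕ}

/-- A constrained best response rule for the utility `u`, with an arbitrary (measurable) rule for
breaking ties: `r C p` maximizes `u (·, p)` over `C`. The value on the empty set is unrestricted. -/
def IsConstrainedBestResponse (u : A → Outcome d → ℝ) (r : Finset A → Outcome d → A) : Prop :=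
  (∀ (C : Finset A) (p : Outcome d), C.Nonempty → r C p ∈ C ∧ ∀ b ∈ C, u b p ≤ u (r C p) p) ∧
    ∀ (C : Finset A) (a : A), MeasurableSet {p | r C p = a}

open Classical in
/-- The candidate action set that the elimination algorithm holds after the rounds of `h`: it starts
with all actions and, after each round, removes those that violate a constraint at the outcome. -/
noncomputable def candidate [Fintype A] (g : Agent A d J) :
    (t : ℕ) → Transcript X d t → Finset A
  | 0, _ => Finset.univ
  | t + 1, h =>
      candidate g t (before h (Fin.last t)) \
        (candidate g t (before h (Fin.last t))).filter
          (fun a => ∃ j, 0 < g.constraint j a (outcome h (Fin.last t)))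

/-- The action played in round `t` by an agent that runs the elimination algorithm. -/
noncomputable def action [Fintype A] (g : Agent A d J) (r : Finset A → Outcome d → A) {T : ℕ}
    (h : Transcript X d T) (t : Fin T) : A :=
  r (candidate g t (before h t)) (prediction h t)

/-- The benchmark class: the actions that satisfy every constraint in every round. -/
def benchmark (g : Agent A d J) {T : ℕ} (h : Transcript X d T) : Set A :=
  {a | ∀ (t : Fin T) (j : Fin J), g.constraint j a (outcome h t) ≤ 0}

/-- Constrained external regret of the actions `a` on the outcomes `y`, against the class `B`. -/
noncomputable def externalRegret (u : A → Outcome d → ℝ) (B : Set A) {T : ℕ}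
    (a : Fin T → A) (y : Fin T → Outcome d) : ℝ :=
  ⨆ b : B, ∑ t, (u b (y t) - u (a t) (y t))

/-- Constrained swap regret of the actions `a` on the outcomes `y`, against the class `B`. -/
noncomputable def swapRegret (u : A → Outcome d → ℝ) (B : Set A) {T : ℕ}
    (a : Fin T → A) (y : Fin T → Outcome d) : ℝ :=
  ⨆ φ : A → B, ∑ t, (u (φ (a t)) (y t) - u (a t) (y t))

end Agents

section Protocol

variable {X : Type*} [MeasurableSpace X] {d : ℕ}

/-- A forecaster: in each round, a distribution of the prediction given the transcript so far and
the current feature. -/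
structure Forecaster (X : Type*) [MeasurableSpace X] (d : ℕ) where
  pred : (t : ℕ) → Kernel (Transcript X d t × X) (Outcome d)
  markov_pred : ∀ t, IsMarkovKernel (pred t)

/-- An adaptive adversary: in each round it chooses, given the transcript so far, a (possibly
random) feature and a distribution of the outcome. -/
structure Adversary (X : Type*) [MeasurableSpace X] (d : ℕ) where
  feat : (t : ℕ) → Kernel (Transcript X d t) X
  out : (t : ℕ) → Kernel (Transcript X d t × X) (Outcome d)
  markov_feat : ∀ t, IsMarkovKernel (feat t)
  markov_out : ∀ t, IsMarkovKernel (out t)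

/-- The law of one round given the past: first the feature; then, independently of each other, the
prediction and the outcome. -/
noncomputable def roundKernel (F : Forecaster X d) (adv : Adversary X d) (t : ℕ) :
    Kernel (Transcript X d t) (Round X d) :=
  adv.feat t ⊗ₖ (F.pred t ×ₖ adv.out t)

/-- The law of the transcript of the first `t` rounds. -/
noncomputable def transcriptLaw (F : Forecaster X d) (adv : Adversary X d) :
    (t : ℕ) → Measure (Transcript X d t)
  | 0 => Measure.dirac (fun s => s.elim0)
  | t + 1 => (transcriptLaw F adv t ⊗ₘ roundKernel F adv t).map
      (fun z => Fin.snoc (α := fun _ => Round X d) z.1 z.2)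

theorem measurable_snoc_round (t : ℕ) :
    Measurable (fun z : Transcript X d t × Round X d =>
      (Fin.snoc (α := fun _ => Round X d) z.1 z.2 : Transcript X d (t + 1))) := by
  refine measurable_pi_lambda _ (fun i => ?_)
  refine Fin.lastCases ?_ (fun j => ?_) i
  · simpa only [Fin.snoc_last] using measurable_snd
  · simp only [Fin.snoc_castSucc]
    exact (measurable_pi_apply j).comp measurable_fst

instance isMarkovKernel_roundKernel (F : Forecaster X d) (adv : Adversary X d) (t : ℕ) :
    IsMarkovKernel (roundKernel F adv t) := by
  have := F.markov_pred t
  have := adv.markov_feat t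
  have := adv.markov_out t
  unfold roundKernel
  infer_instance

instance isProbabilityMeasure_transcriptLaw (F : Forecaster X d) (adv : Adversary X d) (t : ℕ) :
    IsProbabilityMeasure (transcriptLaw F adv t) := by
  induction t with
  | zero => unfold transcriptLaw; infer_instance
  | succ t ih =>
    unfold transcriptLaw
    exact Measure.isProbabilityMeasure_map (measurable_snoc_round t).aemeasurable

end Protocol

section UnbiasedPrediction

variable {X : Type*} [MeasurableSpace X] {d : ℕ}

/-- An event: a function of the transcript so far, the current feature and the prediction. -/
abbrev Event (X : Type*) (d : ℕ) := (t : ℕ) → Transcript X d t → X → Outcome d → ℝ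

variable {ℰ : Type*} [Fintype ℰ]

/-- The expected bias in coordinate `i` on the event `E` in the past round `s`; the expectation is
over the forecaster's distribution of the prediction of that round. -/
noncomputable def expectedBias (F : Forecaster X d) (E : Event X d) {t : ℕ}
    (h : Transcript X d t) (s : Fin t) (i : Fin d) : ℝ :=
  ∫ p, E s (before h s) (feature h s) p * ((p : Fin d → ℝ) i - (outcome h s : Fin d → ℝ) i)
    ∂(F.pred s (before h s, feature h s))

/-- The unnormalized exponential weight of `(E, i, σ)`, where `σ` is a sign. -/
noncomputable def expWeight (F : Forecaster X d) (E : ℰ → Event X d) (η : ℝ) {t : ℕ}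
    (h : Transcript X d t) (e : ℰ) (i : Fin d) (σ : ℤˣ) : ℝ :=
  Real.exp (η / 2 * ∑ s : Fin t, ((σ : ℤ) : ℝ) * expectedBias F (E e) h s i)

/-- The distribution `q` on triples `(E, i, σ)`: the normalized exponential weights. -/
noncomputable def weight (F : Forecaster X d) (E : ℰ → Event X d) (η : ℝ) {t : ℕ}
    (h : Transcript X d t) (e : ℰ) (i : Fin d) (σ : ℤˣ) : ℝ :=
  expWeight F E η h e i σ / ∑ e', ∑ i', ∑ σ', expWeight F E η h e' i' σ'

/-- The objective of the min-max problem of a round, as a function of the distribution `ψ` of the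
prediction: the worst case over outcomes `y` of the expected weighted bias. -/
noncomputable def worstCaseBias (F : Forecaster X d) (E : ℰ → Event X d) (η : ℝ) {t : ℕ}
    (h : Transcript X d t) (x : X) (ψ : Measure (Outcome d)) : ℝ :=
  ⨆ y : Outcome d, ∫ p, ∑ e, ∑ i, ∑ σ : ℤˣ,
    weight F E η h e i σ * ((σ : ℤ) : ℝ) * E e t h x p *
      ((p : Fin d → ℝ) i - (y : Fin d → ℝ) i) ∂ψ

/-- `F` runs the algorithm Unbiased-Prediction for `T` rounds, for the events `E` with learning rate
`η`, solving the min-max problem of each round up to an additive error `ε`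
(with `ε = 0`: exactly). -/
def IsUnbiasedPrediction (F : Forecaster X d) (E : ℰ → Event X d) (η ε : ℝ) (T : ℕ) : Prop :=
  ∀ t < T, ∀ (h : Transcript X d t) (x : X) (ψ : ProbabilityMeasure (Outcome d)),
    worstCaseBias F E η h x (F.pred t (h, x)) ≤
      worstCaseBias F E η h x (ψ : Measure (Outcome d)) + ε

end UnbiasedPrediction

section DecisionCalibration

variable {X A ι : Type*} {d J : ℕ}

open Classical in
/-- The event that agent `i`, running the elimination algorithm, plays the action `a`. -/
noncomputable def decisionEvent [Fintype A] (N : ι → Agent A d J)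
    (r : ι → Finset A → Outcome d → A) (e : ι × A) : Event X d :=
  fun t h _ p => if r e.1 (candidate (N e.1) t h) p = e.2 then 1 else 0

/-- `F` is the forecaster Decision-Calibration-Realization: Unbiased-Prediction for the decision
events of all agents and actions. -/
def IsDecisionCalibrationRealization [MeasurableSpace X] [Fintype A] [Fintype ι]
    (F : Forecaster X d) (N : ι → Agent A d J) (r : ι → Finset A → Outcome d → A)
    (η ε : ℝ) (T : ℕ) : Prop :=
  IsUnbiasedPrediction F (decisionEvent N r) η ε T

end DecisionCalibration

end Omniprediction

/-!
Why the theorem holds. A linear utility on the cube is `u(a, y) = ∑ i, y i * u(a, e i)` with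
nonnegative coefficients of sum at most `L`. If on the rounds where an agent plays `a` the total of
`p - y` is at most `β` in every coordinate, then on these rounds the utility of any fixed action
changes in total by at most `L * β` when the outcomes are replaced by the predictions. Benchmark
actions are never eliminated, and `a` was a best response to the predictions among the candidates,
so replacing `a` by a benchmark action gains at most `2 * L * β`; summing over `a` bounds the swap
regret by `2 * L * |A| * β` (`sum_utility_swap_le`). External regret is the case of constant swaps.

It remains to bound the realized biases of the decision events.

* The min-max problem of a round has value at most `0` (`exists_worstPayoff_le`). Instead of a
  minimax theorem, the proof runs projected online gradient descent on the weighted bias: since its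
  regret vanishes, the uniform distribution over its iterates has worst-case payoff close to `0`.
  So the weighted expected bias of a round is at most the optimization error, and the potential
  argument for exponential weights bounds every expected bias on every transcript
  (`IsUnbiasedPrediction.sum_expectedBias_le`).
* The prediction is independent of the outcome given the past and the feature, so the deviation of
  the realized from the expected bias has conditional mean `0` even given the outcome. Its
  exponential moment is bounded round by round with Hoeffding's lemma; Markov's inequality and a
  union bound over events, coordinates and signs give the high-probability bound
  (`IsUnbiasedPrediction.measure_abs_sum_realizedBias_le`).

With at least two actions, `log (d |A| |N| T / δ) ≥ log 2` absorbs all additive constants; with one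
action there is no regret.

A forecaster exists (`exists_isUnbiasedPrediction`) because the objective of a round is Lipschitz in
the weights, uniformly in the prediction distribution, and otherwise depends on the transcript only
through the finitely many possible candidate sets: a near-minimizer may be chosen separately on each
cell of a countable measurable partition of the transcripts.
-/

namespace Omniprediction

/-! ### Linear utilities and the elimination algorithm -/

section Utility

variable {A : Type*} {d J : ℕ}

lemma Outcome.coord_mem (y : Outcome d) (i : Fin d) : (y : Fin d → ℝ) i ∈ Set.Icc (0 : ℝ) 1 :=
  ⟨y.2.1 i, y.2.2 i⟩

/-- The `i`-th standard basis vector, as an outcome. -/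
noncomputable def basisOutcome (i : Fin d) : Outcome d :=
  ⟨Pi.single i 1, fun j => by
    by_cases h : j = i
    · subst h; simp
    · simp [h], fun j => by
    by_cases h : j = i
    · subst h; simp
    · simp [h]⟩

open Classical in
/-- The outcome `y` with the coordinates outside `s` replaced by `0`. -/
noncomputable def truncateOutcome (s : Finset (Fin d)) (y : Outcome d) : Outcome d :=
  ⟨fun i => if i ∈ s then (y : Fin d → ℝ) i else 0, fun i => by
    have := (y.coord_mem i).1
    by_cases h : i ∈ s <;> simp [h, this], fun i => by
    have := (y.coord_mem i).2
    by_cases h : i ∈ s <;> simp [h, this]⟩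

lemma Agent.LinearUtility.utility_truncate {g : Agent A d J} (hg : g.LinearUtility) (a : A)
    (y : Outcome d) (s : Finset (Fin d)) :
    g.utility a (truncateOutcome s y) =
      ∑ i ∈ s, (y : Fin d → ℝ) i * g.utility a (basisOutcome i) := by
  classical
  induction s using Finset.induction_on with
  | empty =>
    have := hg a 0 0 y y (truncateOutcome ∅ y) (by ext i; simp [truncateOutcome])
    simpa using this
  | insert j s hj ih =>
    have := hg a 1 ((y : Fin d → ℝ) j) (truncateOutcome s y) (basisOutcome j)
      (truncateOutcome (insert j s) y) (by
        ext i
        by_cases h : i = j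
        · subst h; simp [truncateOutcome, basisOutcome, hj]
        · simp [truncateOutcome, basisOutcome, h])
    rw [this, Finset.sum_insert hj, ih]; ring

lemma Agent.LinearUtility.utility_eq_sum {g : Agent A d J} (hg : g.LinearUtility) (a : A)
    (y : Outcome d) :
    g.utility a y = ∑ i, (y : Fin d → ℝ) i * g.utility a (basisOutcome i) := by
  rw [← hg.utility_truncate]
  congr 1
  ext i; simp [truncateOutcome]

/-- The coefficients of a linear utility are nonnegative and sum to `u(a, 1) - u(a, 0)`, so the
sup-norm Lipschitz constant bounds their sum. -/
lemma Agent.LinearUtility.sum_utility_basis_le {g : Agent A d J} (hg : g.LinearUtility) {L : ℝ}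
    (hL : g.LipschitzUtility L) (hd : 0 < d) (a : A) :
    ∑ i, g.utility a (basisOutcome i) ≤ L := by
  have : Nonempty (Fin d) := ⟨⟨0, hd⟩⟩
  have h1 := hg.utility_eq_sum a ⟨1, zero_le_one, le_rfl⟩
  have h0 := hg.utility_eq_sum a ⟨0, le_rfl, zero_le_one⟩
  have h := hL a ⟨1, zero_le_one, le_rfl⟩ ⟨0, le_rfl, zero_le_one⟩
  simp only [Pi.one_apply, one_mul, Pi.zero_apply, zero_mul, Finset.sum_const_zero] at h1 h0
  rw [h0, h1] at h
  simp only [sub_zero, norm_one, mul_one] at h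
  exact (le_abs_self _).trans h

lemma Agent.LinearUtility.lipschitz_nonneg {g : Agent A d J} (hg : g.LinearUtility) {L : ℝ}
    (hL : g.LipschitzUtility L) (hd : 0 < d) (a : A) : 0 ≤ L :=
  (Finset.sum_nonneg fun _ _ => (g.utility_mem a _).1).trans (hg.sum_utility_basis_le hL hd a)

/-- Passing from predictions to outcomes changes the total utility of a fixed action, on rounds
weighted by `w`, by at most `L` times the largest coordinate bias. -/
lemma Agent.LinearUtility.abs_sum_utility_sub_le {g : Agent A d J} (hg : g.LinearUtility) {L : ℝ}
    (hL : g.LipschitzUtility L) (hd : 0 < d) {T : ℕ} (w : Fin T → ℝ) (p y : Fin T → Outcome d)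
    {β : ℝ} (hβ : ∀ i, |∑ t, w t * ((p t : Fin d → ℝ) i - (y t : Fin d → ℝ) i)| ≤ β) (a : A) :
    |∑ t, w t * (g.utility a (p t) - g.utility a (y t))| ≤ L * β := by
  have hβ0 : 0 ≤ β := (abs_nonneg _).trans (hβ ⟨0, hd⟩)
  have h : ∑ t, w t * (g.utility a (p t) - g.utility a (y t)) =
      ∑ i, g.utility a (basisOutcome i) *
        ∑ t, w t * ((p t : Fin d → ℝ) i - (y t : Fin d → ℝ) i) := by
    simp_rw [Finset.mul_sum]
    rw [Finset.sum_comm]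
    refine Finset.sum_congr rfl fun t _ => ?_
    rw [hg.utility_eq_sum a (p t), hg.utility_eq_sum a (y t), ← Finset.sum_sub_distrib,
      Finset.mul_sum]
    exact Finset.sum_congr rfl fun i _ => by ring
  rw [h]
  calc _ ≤ ∑ i, |g.utility a (basisOutcome i) *
        ∑ t, w t * ((p t : Fin d → ℝ) i - (y t : Fin d → ℝ) i)| := Finset.abs_sum_le_sum_abs _ _
    _ ≤ ∑ i, g.utility a (basisOutcome i) * β := by
        refine Finset.sum_le_sum fun i _ => ?_
        rw [abs_mul, abs_of_nonneg (g.utility_mem a _).1]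
        exact mul_le_mul_of_nonneg_left (hβ i) (g.utility_mem a _).1
    _ ≤ L * β := by
        rw [← Finset.sum_mul]
        exact mul_le_mul_of_nonneg_right (hg.sum_utility_basis_le hL hd a) hβ0

end Utility

section Elimination

variable {X A : Type*} {d J : ℕ} [Fintype A]

lemma mem_candidate (g : Agent A d J) (a : A) : ∀ (t : ℕ) (h : Transcript X d t),
    a ∈ candidate g t h ↔ ∀ (s : Fin t) (j : Fin J), g.constraint j a (outcome h s) ≤ 0
  | 0, h => by simp [candidate]
  | t + 1, h => by
    rw [candidate, Fin.forall_fin_succ']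
    simp only [Finset.mem_sdiff, Finset.mem_filter, mem_candidate g a t, not_and, not_exists,
      not_lt]
    exact ⟨fun H => ⟨H.1, H.2 H.1⟩, fun H => ⟨H.1, fun _ => H.2⟩⟩

/-- A benchmark action satisfies all constraints in all rounds, so it is never eliminated. -/
lemma benchmark_mem_candidate (g : Agent A d J) {T : ℕ} (h : Transcript X d T) {a : A}
    (ha : a ∈ benchmark g h) (t : Fin T) : a ∈ candidate g t (before h t) :=
  (mem_candidate g a t _).2 fun s j => ha (Fin.castLE t.isLt.le s) j

open Classical in
/-- If the decision events are unbiased up to `β`, then replacing every action `a` by a benchmark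
action `φ a` gains at most `2 L |A| β`: on the rounds where `a` is played, `a` is a best response
to the predictions among candidates that include `φ a`. -/
lemma sum_utility_swap_le {g : Agent A d J} (hg : g.LinearUtility) {L : ℝ}
    (hL : g.LipschitzUtility L) (hd : 0 < d) {r : Finset A → Outcome d → A}
    (hr : IsConstrainedBestResponse g.utility r) {T : ℕ} (h : Transcript X d T) {β : ℝ}
    (hβ : ∀ a i, |∑ t, (if action g r h t = a then 1 else 0) *
      ((prediction h t : Fin d → ℝ) i - (outcome h t : Fin d → ℝ) i)| ≤ β)
    (φ : A → A) (hφ : ∀ a, φ a ∈ benchmark g h) :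
    ∑ t, (g.utility (φ (action g r h t)) (outcome h t) -
      g.utility (action g r h t) (outcome h t)) ≤ 2 * L * Fintype.card A * β := by
  have key : ∀ a, ∑ t, (if action g r h t = a then 1 else 0) *
      (g.utility (φ a) (outcome h t) - g.utility a (outcome h t)) ≤ 2 * (L * β) := by
    intro a
    have h1 := hg.abs_sum_utility_sub_le hL hd _ _ _ (hβ a) (φ a)
    have h2 := hg.abs_sum_utility_sub_le hL hd _ _ _ (hβ a) a
    have h3 : ∑ t, (if action g r h t = a then 1 else 0) *
        (g.utility (φ a) (prediction h t) - g.utility a (prediction h t)) ≤ 0 := by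
      refine Finset.sum_nonpos fun t _ => ?_
      split_ifs with hta
      · have hmem := benchmark_mem_candidate g h (hφ a) t
        have := (hr.1 _ (prediction h t) ⟨_, hmem⟩).2 _ hmem
        rw [← hta]
        rw [← hta] at this
        unfold action at this ⊢
        linarith
      · simp
    have h4 : ∑ t, (if action g r h t = a then 1 else 0) *
        (g.utility (φ a) (outcome h t) - g.utility a (outcome h t)) =
        ∑ t, (if action g r h t = a then 1 else 0) *
          (g.utility (φ a) (prediction h t) - g.utility a (prediction h t)) -
        ∑ t, (if action g r h t = a then 1 else 0) *
          (g.utility (φ a) (prediction h t) - g.utility (φ a) (outcome h t)) +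
        ∑ t, (if action g r h t = a then 1 else 0) *
          (g.utility a (prediction h t) - g.utility a (outcome h t)) := by
      rw [← Finset.sum_sub_distrib, ← Finset.sum_add_distrib]
      exact Finset.sum_congr rfl fun t _ => by ring
    rw [h4]
    have := (abs_le.1 h1).1
    have := (abs_le.1 h2).2
    linarith
  calc _ = ∑ a, ∑ t, (if action g r h t = a then 1 else 0) *
        (g.utility (φ a) (outcome h t) - g.utility a (outcome h t)) := by
        rw [Finset.sum_comm]
        exact Finset.sum_congr rfl fun t _ => by simp
    _ ≤ ∑ _a : A, 2 * (L * β) := Finset.sum_le_sum fun a _ => key a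
    _ = 2 * L * Fintype.card A * β := by
        rw [Finset.sum_const, Finset.card_univ, nsmul_eq_mul]; ring

end Elimination

section Regret

variable {A : Type*} {d : ℕ}

lemma swapRegret_le {u : A → Outcome d → ℝ} {B : Set A} (hB : B.Nonempty) {T : ℕ}
    {a : Fin T → A} {y : Fin T → Outcome d} {M : ℝ}
    (H : ∀ φ : A → A, (∀ a, φ a ∈ B) → ∑ t, (u (φ (a t)) (y t) - u (a t) (y t)) ≤ M) :
    swapRegret u B a y ≤ M := by
  have : Nonempty B := hB.to_subtype
  exact ciSup_le fun φ => H (fun a => φ a) fun a => (φ a).2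

lemma externalRegret_le {u : A → Outcome d → ℝ} {B : Set A} (hB : B.Nonempty) {T : ℕ}
    {a : Fin T → A} {y : Fin T → Outcome d} {M : ℝ}
    (H : ∀ φ : A → A, (∀ a, φ a ∈ B) → ∑ t, (u (φ (a t)) (y t) - u (a t) (y t)) ≤ M) :
    externalRegret u B a y ≤ M := by
  have : Nonempty B := hB.to_subtype
  exact ciSup_le fun b => H (fun _ => b) fun _ => b.2

end Regret

/-! ### The min-max problem of a round -/

section Game

variable {d : ℕ} {ℰ : Type*} [Fintype ℰ]

/-- The payoff of the min-max problem of a round for the pure choices `p` and `y`: the bias weighted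
by `q`, where `G e` is the event `e` as a function of the prediction. -/
noncomputable def payoff (G : ℰ → Outcome d → ℝ) (q : ℰ → Fin d → ℤˣ → ℝ) (p y : Outcome d) : ℝ :=
  ∑ e, ∑ i, ∑ σ : ℤˣ, q e i σ * ((σ : ℤ) : ℝ) * G e p * ((p : Fin d → ℝ) i - (y : Fin d → ℝ) i)

/-- The worst case over outcomes of the expected payoff of the prediction distribution `ψ`. -/
noncomputable def worstPayoff (G : ℰ → Outcome d → ℝ) (q : ℰ → Fin d → ℤˣ → ℝ)
    (ψ : Measure (Outcome d)) : ℝ :=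
  ⨆ y : Outcome d, ∫ p, payoff G q p y ∂ψ

lemma abs_intUnit (σ : ℤˣ) : |((σ : ℤ) : ℝ)| = 1 := by
  rcases Int.units_eq_one_or σ with rfl | rfl <;> simp

lemma abs_coord_sub_le (p y : Outcome d) (i : Fin d) :
    |(p : Fin d → ℝ) i - (y : Fin d → ℝ) i| ≤ 1 := by
  have := p.coord_mem i
  have := y.coord_mem i
  simp only [Set.mem_Icc] at *
  rw [abs_le]
  constructor <;> linarith

lemma measurable_coord (i : Fin d) : Measurable fun p : Outcome d => (p : Fin d → ℝ) i :=
  (measurable_pi_apply i).comp measurable_subtype_coe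

lemma measurable_payoff {G : ℰ → Outcome d → ℝ} (hG : ∀ e, Measurable (G e))
    (q : ℰ → Fin d → ℤˣ → ℝ) (y : Outcome d) : Measurable fun p => payoff G q p y := by
  unfold payoff
  refine Finset.measurable_sum _ fun e _ => Finset.measurable_sum _ fun i _ =>
    Finset.measurable_sum _ fun σ _ => ?_
  exact ((hG e).const_mul _).mul ((measurable_coord i).sub_const _)

lemma abs_payoff_le {G : ℰ → Outcome d → ℝ} (hG : ∀ e p, |G e p| ≤ 1)
    (q : ℰ → Fin d → ℤˣ → ℝ) (p y : Outcome d) :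
    |payoff G q p y| ≤ ∑ e, ∑ i, ∑ σ, |q e i σ| := by
  unfold payoff
  refine (Finset.abs_sum_le_sum_abs _ _).trans (Finset.sum_le_sum fun e _ => ?_)
  refine (Finset.abs_sum_le_sum_abs _ _).trans (Finset.sum_le_sum fun i _ => ?_)
  refine (Finset.abs_sum_le_sum_abs _ _).trans (Finset.sum_le_sum fun σ _ => ?_)
  rw [abs_mul, abs_mul, abs_mul, abs_intUnit, mul_one, mul_assoc]
  exact mul_le_of_le_one_right (abs_nonneg _)
    (mul_le_one₀ (hG e p) (abs_nonneg _) (abs_coord_sub_le p y i))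

lemma integrable_payoff {G : ℰ → Outcome d → ℝ} (hGm : ∀ e, Measurable (G e))
    (hG : ∀ e p, |G e p| ≤ 1) (q : ℰ → Fin d → ℤˣ → ℝ) (y : Outcome d)
    (ψ : Measure (Outcome d)) [IsFiniteMeasure ψ] : Integrable (fun p => payoff G q p y) ψ :=
  .of_bound (measurable_payoff hGm q y).aestronglyMeasurable _
    (.of_forall fun p => abs_payoff_le hG q p y)

lemma abs_integral_payoff_le {G : ℰ → Outcome d → ℝ} (hG : ∀ e p, |G e p| ≤ 1)
    (q : ℰ → Fin d → ℤˣ → ℝ) (y : Outcome d) (ψ : Measure (Outcome d)) [IsProbabilityMeasure ψ] :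
    |∫ p, payoff G q p y ∂ψ| ≤ ∑ e, ∑ i, ∑ σ, |q e i σ| := by
  have := norm_integral_le_of_norm_le_const (μ := ψ) (f := fun p => payoff G q p y)
    (.of_forall fun p => abs_payoff_le hG q p y)
  simpa using this

lemma le_worstPayoff {G : ℰ → Outcome d → ℝ} (hG : ∀ e p, |G e p| ≤ 1)
    (q : ℰ → Fin d → ℤˣ → ℝ) (y : Outcome d) (ψ : Measure (Outcome d)) [IsProbabilityMeasure ψ] :
    ∫ p, payoff G q p y ∂ψ ≤ worstPayoff G q ψ := by
  refine le_ciSup (f := fun y => ∫ p, payoff G q p y ∂ψ) ⟨∑ e, ∑ i, ∑ σ, |q e i σ|, ?_⟩ y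
  rintro _ ⟨y, rfl⟩
  exact (abs_le.1 (abs_integral_payoff_le hG q y ψ)).2

instance : Nonempty (Outcome d) := ⟨⟨0, le_rfl, zero_le_one⟩⟩

lemma neg_le_worstPayoff {G : ℰ → Outcome d → ℝ} (hG : ∀ e p, |G e p| ≤ 1)
    (q : ℰ → Fin d → ℤˣ → ℝ) (ψ : Measure (Outcome d)) [IsProbabilityMeasure ψ] :
    -∑ e, ∑ i, ∑ σ, |q e i σ| ≤ worstPayoff G q ψ :=
  (abs_le.1 (abs_integral_payoff_le hG q (Classical.arbitrary _) ψ)).1.trans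
    (le_worstPayoff hG q _ ψ)

/-- The worst-case payoff is Lipschitz in the weights, uniformly in the prediction distribution. -/
lemma worstPayoff_le_add {G : ℰ → Outcome d → ℝ} (hGm : ∀ e, Measurable (G e))
    (hG : ∀ e p, |G e p| ≤ 1) (q q' : ℰ → Fin d → ℤˣ → ℝ)
    (ψ : Measure (Outcome d)) [IsProbabilityMeasure ψ] :
    worstPayoff G q ψ ≤ worstPayoff G q' ψ + ∑ e, ∑ i, ∑ σ, |q e i σ - q' e i σ| := by
  refine ciSup_le fun y => ?_
  have h1 : ∀ p, payoff G q p y =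
      payoff G q' p y + payoff G (fun e i σ => q e i σ - q' e i σ) p y := by
    intro p
    unfold payoff
    simp_rw [← Finset.sum_add_distrib]
    refine Finset.sum_congr rfl fun e _ => Finset.sum_congr rfl fun i _ =>
      Finset.sum_congr rfl fun σ _ => by ring
  simp_rw [h1]
  rw [integral_add (integrable_payoff hGm hG _ _ _) (integrable_payoff hGm hG _ _ _)]
  exact add_le_add (le_worstPayoff hG q' y ψ) (abs_le.1 (abs_integral_payoff_le hG _ y ψ)).2

/-- A minimizer up to `ε` exists for every `ε > 0`, because the worst-case payoff is bounded below.
An exact minimizer need not exist, as the events may be discontinuous in the prediction. -/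
lemma exists_worstPayoff_le_add {G : ℰ → Outcome d → ℝ} (hG : ∀ e p, |G e p| ≤ 1)
    (q : ℰ → Fin d → ℤˣ → ℝ) {ε : ℝ} (hε : 0 < ε) :
    ∃ ψ : ProbabilityMeasure (Outcome d), ∀ ψ' : ProbabilityMeasure (Outcome d),
      worstPayoff G q ψ ≤ worstPayoff G q ψ' + ε := by
  have : Nonempty (ProbabilityMeasure (Outcome d)) :=
    ⟨⟨Measure.dirac (Classical.arbitrary _), inferInstance⟩⟩
  have hb : BddBelow (Set.range fun ψ : ProbabilityMeasure (Outcome d) => worstPayoff G q ψ) := by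
    refine ⟨-∑ e, ∑ i, ∑ σ, |q e i σ|, ?_⟩
    rintro _ ⟨ψ, rfl⟩
    exact neg_le_worstPayoff hG q ψ
  obtain ⟨ψ, hψ⟩ := exists_lt_of_ciInf_lt (lt_add_of_pos_right
    (⨅ ψ : ProbabilityMeasure (Outcome d), worstPayoff G q ψ) hε)
  exact ⟨ψ, fun ψ' => hψ.le.trans (by gcongr; exact ciInf_le hb ψ')⟩

end Game

section GradientDescent

variable {d : ℕ}

/-- Coordinatewise projection of a vector onto the cube `[0,1]^d`. -/
noncomputable def clampOutcome (z : Fin d → ℝ) : Outcome d :=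
  ⟨fun i => max 0 (min 1 (z i)), fun _ => le_max_left _ _,
    fun _ => max_le zero_le_one (min_le_left _ _)⟩

/-- Projected online gradient descent with step size `α` along the vector field `f`. -/
noncomputable def gradientDescent (f : Outcome d → Fin d → ℝ) (α : ℝ) : ℕ → Outcome d
  | 0 => clampOutcome 0
  | k + 1 => clampOutcome fun i =>
      (gradientDescent f α k : Fin d → ℝ) i - α * f (gradientDescent f α k) i

lemma sq_clamp_sub_le (z : ℝ) {y : ℝ} (hy : y ∈ Set.Icc (0 : ℝ) 1) :
    (max 0 (min 1 z) - y) ^ 2 ≤ (z - y) ^ 2 := by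
  obtain ⟨h0, h1⟩ := hy
  rcases le_total z 0 with hz | hz
  · rw [min_eq_right (by linarith), max_eq_left hz]; nlinarith
  · rcases le_total z 1 with hz' | hz'
    · rw [min_eq_right hz', max_eq_right hz]
    · rw [min_eq_left hz', max_eq_right zero_le_one]; nlinarith

/-- The regret of online gradient descent for the linear losses `⟨f (p k), ·⟩`, with the squared
distance to the comparator `y` as a potential. -/
lemma gradientDescent_regret (f : Outcome d → Fin d → ℝ) {S : ℝ} (hf : ∀ p i, |f p i| ≤ S)
    (α : ℝ) (y : Outcome d) (n : ℕ) :
    2 * α * (∑ k ∈ Finset.range n, ∑ i, f (gradientDescent f α k) i *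
        ((gradientDescent f α k : Fin d → ℝ) i - (y : Fin d → ℝ) i)) +
      ∑ i, ((gradientDescent f α n : Fin d → ℝ) i - (y : Fin d → ℝ) i) ^ 2 ≤
      d + n * (d * (α ^ 2 * S ^ 2)) := by
  induction n with
  | zero =>
    simp only [Finset.range_zero, Finset.sum_empty, mul_zero, zero_add, Nat.cast_zero, zero_mul,
      add_zero]
    calc _ ≤ ∑ _i : Fin d, (1 : ℝ) := Finset.sum_le_sum fun i _ => by
          have := abs_coord_sub_le (gradientDescent f α 0) y i
          rwa [sq_le_one_iff_abs_le_one]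
      _ = d := by simp
  | succ n ih =>
    set p := gradientDescent f α n with hp
    have hstep : ∑ i, ((gradientDescent f α (n + 1) : Fin d → ℝ) i - (y : Fin d → ℝ) i) ^ 2 ≤
        ∑ i, ((p : Fin d → ℝ) i - (y : Fin d → ℝ) i) ^ 2 -
          2 * α * ∑ i, f p i * ((p : Fin d → ℝ) i - (y : Fin d → ℝ) i) +
          d * (α ^ 2 * S ^ 2) := by
      calc _ ≤ ∑ i, (((p : Fin d → ℝ) i - (y : Fin d → ℝ) i) ^ 2 -
            2 * α * (f p i * ((p : Fin d → ℝ) i - (y : Fin d → ℝ) i)) + α ^ 2 * S ^ 2) := by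
            refine Finset.sum_le_sum fun i _ => ?_
            have h1 := sq_clamp_sub_le ((p : Fin d → ℝ) i - α * f p i) (y.coord_mem i)
            have h2 : (f p i) ^ 2 ≤ S ^ 2 := sq_le_sq' (abs_le.1 (hf p i)).1 (abs_le.1 (hf p i)).2
            have h3 := mul_le_mul_of_nonneg_left h2 (sq_nonneg α)
            refine h1.trans ?_
            nlinarith
        _ = _ := by
            rw [Finset.sum_add_distrib, Finset.sum_sub_distrib, ← Finset.mul_sum]
            simp
    rw [Finset.sum_range_succ, ← hp]
    push_cast
    linarith

/-- There are finitely many predictions whose average loss against every outcome, along the field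
`f`, is at most `ε`. -/
lemma exists_average_le (f : Outcome d → Fin d → ℝ) {S : ℝ} (hf : ∀ p i, |f p i| ≤ S)
    {ε : ℝ} (hε : 0 < ε) : ∃ (n : ℕ) (p : ℕ → Outcome d), 0 < n ∧ ∀ y : Outcome d,
      ∑ k ∈ Finset.range n, ∑ i, f (p k) i * ((p k : Fin d → ℝ) i - (y : Fin d → ℝ) i) ≤
        n * ε := by
  -- The step size makes the gradient term `α * d * S ^ 2 / 2` of the average regret at most
  -- `ε / 2`; the initial-distance term `d / (2 * α * n)` is at most `ε / 2` once `n` is large.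
  set α := ε / (d * S ^ 2 + 1) with hα
  have hden : 0 < d * S ^ 2 + 1 := by positivity
  have hα0 : 0 < α := by positivity
  obtain ⟨n, hn⟩ := exists_nat_gt (d / (α * ε))
  have hn0 : (0 : ℝ) < n := lt_of_le_of_lt (by positivity) hn
  refine ⟨n, gradientDescent f α, by exact_mod_cast hn0, fun y => ?_⟩
  have h := gradientDescent_regret f hf α y n
  have hpos : 0 ≤ ∑ i, ((gradientDescent f α n : Fin d → ℝ) i - (y : Fin d → ℝ) i) ^ 2 :=
    Finset.sum_nonneg fun _ _ => sq_nonneg _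
  rw [div_lt_iff₀ (by positivity)] at hn
  have h2 : α * (d * S ^ 2) ≤ ε := by
    rw [hα, div_mul_eq_mul_div, div_le_iff₀ hden]
    nlinarith
  have h3 : (n : ℝ) * (d * (α ^ 2 * S ^ 2)) ≤ n * (α * ε) := by
    have := mul_le_mul_of_nonneg_left h2 hα0.le
    refine mul_le_mul_of_nonneg_left ?_ hn0.le
    linarith
  have h4 : (2 * α) * (∑ k ∈ Finset.range n, ∑ i, f (gradientDescent f α k) i *
      ((gradientDescent f α k : Fin d → ℝ) i - (y : Fin d → ℝ) i)) ≤ (2 * α) * (n * ε) := by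
    linarith
  exact le_of_mul_le_mul_left h4 (by positivity)

/-- The value of the min-max problem is at most `0`. The predictions visited by online gradient
descent along the weighted bias have vanishing regret, so their uniform distribution has worst-case
payoff close to `0`; no regularity of the events in the prediction is needed. -/
lemma exists_worstPayoff_le {ℰ : Type*} [Fintype ℰ] {G : ℰ → Outcome d → ℝ}
    (hGm : ∀ e, Measurable (G e)) (hG : ∀ e p, |G e p| ≤ 1) (q : ℰ → Fin d → ℤˣ → ℝ)
    {ε : ℝ} (hε : 0 < ε) :
    ∃ ψ : ProbabilityMeasure (Outcome d), worstPayoff G q ψ ≤ ε := by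
  set f : Outcome d → Fin d → ℝ := fun p i => ∑ e, ∑ σ : ℤˣ, q e i σ * ((σ : ℤ) : ℝ) * G e p
    with hf
  have hpay : ∀ p y, payoff G q p y =
      ∑ i, f p i * ((p : Fin d → ℝ) i - (y : Fin d → ℝ) i) := by
    intro p y
    unfold payoff
    rw [Finset.sum_comm]
    refine Finset.sum_congr rfl fun i _ => ?_
    simp only [hf, Finset.sum_mul]
  have hfb : ∀ p i, |f p i| ≤ ∑ i, ∑ e, ∑ σ, |q e i σ| := by
    intro p i
    refine le_trans ?_ (Finset.single_le_sum (f := fun i => ∑ e, ∑ σ, |q e i σ|)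
      (fun i _ => Finset.sum_nonneg fun e _ => Finset.sum_nonneg fun σ _ => abs_nonneg _)
      (Finset.mem_univ i))
    refine (Finset.abs_sum_le_sum_abs _ _).trans (Finset.sum_le_sum fun e _ => ?_)
    refine (Finset.abs_sum_le_sum_abs _ _).trans (Finset.sum_le_sum fun σ _ => ?_)
    rw [abs_mul, abs_mul, abs_intUnit, mul_one]
    exact mul_le_of_le_one_right (abs_nonneg _) (hG e p)
  obtain ⟨n, p, hn, hp⟩ := exists_average_le f hfb hε
  have hn' : (n : ENNReal) ≠ 0 := by exact_mod_cast hn.ne'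
  refine ⟨⟨(n : ENNReal)⁻¹ • ∑ k ∈ Finset.range n, Measure.dirac (p k), ⟨?_⟩⟩, ?_⟩
  · simp [ENNReal.inv_mul_cancel hn' (ENNReal.natCast_ne_top n)]
  · refine ciSup_le fun y => ?_
    simp only [ProbabilityMeasure.coe_mk]
    rw [integral_smul_measure, integral_finsetSum_measure
      fun k _ => integrable_payoff hGm hG q y _]
    simp only [integral_dirac, hpay, ENNReal.toReal_inv, ENNReal.toReal_natCast, smul_eq_mul]
    have hn0 : (0 : ℝ) < n := by exact_mod_cast hn
    rw [inv_mul_le_iff₀ hn0]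
    exact hp y

end GradientDescent

/-! ### Measurability of the weights -/

section Measurability

variable {X : Type*} [MeasurableSpace X] {d : ℕ}

/-- A family of jointly measurable events with values in `[-1,1]`. -/
structure IsBoundedEventFamily {ℰ : Type*} (E : ℰ → Event X d) : Prop where
  measurable : ∀ e t, Measurable fun z : (Transcript X d t × X) × Outcome d => E e t z.1.1 z.1.2 z.2
  abs_le_one : ∀ e t h x p, |E e t h x p| ≤ 1

lemma measurable_before {t : ℕ} (s : Fin t) :
    Measurable fun h : Transcript X d t => before h s :=
  measurable_pi_lambda _ fun r => measurable_pi_apply (Fin.castLE s.isLt.le r)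

lemma measurable_feature {t : ℕ} (s : Fin t) :
    Measurable fun h : Transcript X d t => feature h s :=
  measurable_fst.comp (measurable_pi_apply s)

lemma measurable_prediction {t : ℕ} (s : Fin t) :
    Measurable fun h : Transcript X d t => prediction h s :=
  (measurable_fst.comp measurable_snd).comp (measurable_pi_apply s)

lemma measurable_outcome {t : ℕ} (s : Fin t) :
    Measurable fun h : Transcript X d t => outcome h s :=
  (measurable_snd.comp measurable_snd).comp (measurable_pi_apply s)

variable {ℰ : Type*} {E : ℰ → Event X d}

lemma IsBoundedEventFamily.measurable_apply (hE : IsBoundedEventFamily E) (e : ℰ) {t : ℕ}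
    (h : Transcript X d t) (x : X) : Measurable (E e t h x) :=
  (hE.measurable e t).comp (measurable_prodMk_left (x := (h, x)))

lemma IsBoundedEventFamily.abs_bias_le (hE : IsBoundedEventFamily E) (e : ℰ) {t : ℕ}
    (h : Transcript X d t) (x : X) (p y : Outcome d) (i : Fin d) :
    |E e t h x p * ((p : Fin d → ℝ) i - (y : Fin d → ℝ) i)| ≤ 1 := by
  rw [abs_mul]
  exact mul_le_one₀ (hE.abs_le_one _ _ _ _ _) (abs_nonneg _) (abs_coord_sub_le _ _ _)

lemma IsBoundedEventFamily.measurable_bias (hE : IsBoundedEventFamily E) (e : ℰ) {t : ℕ}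
    (h : Transcript X d t) (x : X) (y : Outcome d) (i : Fin d) :
    Measurable fun p => E e t h x p * ((p : Fin d → ℝ) i - (y : Fin d → ℝ) i) :=
  (hE.measurable_apply e h x).mul ((measurable_coord i).sub_const _)

lemma IsBoundedEventFamily.abs_expectedBias_le (hE : IsBoundedEventFamily E) (F : Forecaster X d)
    (e : ℰ) {t : ℕ} (h : Transcript X d t) (s : Fin t) (i : Fin d) :
    |expectedBias F (E e) h s i| ≤ 1 := by
  have := F.markov_pred s
  have := norm_integral_le_of_norm_le_const (μ := F.pred s (before h s, feature h s))
    (f := fun p => E e s (before h s) (feature h s) p *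
      ((p : Fin d → ℝ) i - (outcome h s : Fin d → ℝ) i))
    (.of_forall fun p => hE.abs_bias_le e _ _ p _ i)
  simpa [expectedBias] using this

lemma IsBoundedEventFamily.measurable_expectedBias (hE : IsBoundedEventFamily E)
    (F : Forecaster X d) (e : ℰ) {t : ℕ} (s : Fin t) (i : Fin d) :
    Measurable fun h : Transcript X d t => expectedBias F (E e) h s i := by
  have := F.markov_pred s
  have hm : Measurable fun h : Transcript X d t => (before h s, feature h s) :=
    (measurable_before s).prodMk (measurable_feature s)
  have hf : Measurable fun z : Transcript X d t × Outcome d =>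
      E e s (before z.1 s) (feature z.1 s) z.2 *
        ((z.2 : Fin d → ℝ) i - (outcome z.1 s : Fin d → ℝ) i) :=
    ((hE.measurable e s).comp ((hm.comp measurable_fst).prodMk measurable_snd)).mul
      (((measurable_coord i).comp measurable_snd).sub
        ((measurable_coord i).comp ((measurable_outcome s).comp measurable_fst)))
  exact (hf.stronglyMeasurable.integral_kernel_prod_right'
    (κ := (F.pred s).comap _ hm)).measurable

lemma IsBoundedEventFamily.measurable_expWeight (hE : IsBoundedEventFamily E)
    (F : Forecaster X d) (η : ℝ) (t : ℕ) (e : ℰ) (i : Fin d) (σ : ℤˣ) :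
    Measurable fun h : Transcript X d t => expWeight F E η h e i σ := by
  unfold expWeight
  exact Real.measurable_exp.comp ((Finset.measurable_sum _ fun s _ =>
    (hE.measurable_expectedBias F e s i).const_mul _).const_mul _)

lemma IsBoundedEventFamily.measurable_weight [Fintype ℰ] (hE : IsBoundedEventFamily E)
    (F : Forecaster X d) (η : ℝ) (t : ℕ) (e : ℰ) (i : Fin d) (σ : ℤˣ) :
    Measurable fun h : Transcript X d t => weight F E η h e i σ := by
  unfold weight
  exact (hE.measurable_expWeight F η t e i σ).div (Finset.measurable_sum _ fun e _ =>
    Finset.measurable_sum _ fun i _ => Finset.measurable_sum _ fun σ _ =>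
      hE.measurable_expWeight F η t e i σ)

end Measurability

section Congr

variable {X : Type*} [MeasurableSpace X] {d : ℕ} {ℰ : Type*} [Fintype ℰ]

/-- The weights of round `t` depend on the forecaster only through the earlier rounds. -/
lemma weight_congr {F F' : Forecaster X d} {t : ℕ} (hF : ∀ s < t, F.pred s = F'.pred s)
    (E : ℰ → Event X d) (η : ℝ) (h : Transcript X d t) :
    weight F E η h = weight F' E η h := by
  have h1 : ∀ e, expectedBias F (E e) h = expectedBias F' (E e) h := by
    intro e; ext s i; unfold expectedBias; rw [hF s s.2]
  have h2 : expWeight F E η h = expWeight F' E η h := by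
    ext e i σ; unfold expWeight; rw [h1]
  ext e i σ; unfold weight; rw [h2]

lemma worstCaseBias_eq (F : Forecaster X d) (E : ℰ → Event X d) (η : ℝ) {t : ℕ}
    (h : Transcript X d t) (x : X) (ψ : Measure (Outcome d)) :
    worstCaseBias F E η h x ψ = worstPayoff (fun e => E e t h x) (weight F E η h) ψ := rfl

end Congr

/-! ### Existence of the forecaster -/

section Existence

variable {X : Type*} [MeasurableSpace X] {d : ℕ}

/-- A choice of a distribution that depends on the transcript only through a countably-valued
measurable statistic is a kernel. -/
noncomputable def codedKernel {t : ℕ} {K : Type*} [Countable K] (c : Transcript X d t → K)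
    (hc : ∀ k, MeasurableSet (c ⁻¹' {k})) (ψ : K → ProbabilityMeasure (Outcome d)) :
    Kernel (Transcript X d t × X) (Outcome d) where
  toFun z := ψ (c z.1)
  measurable' := by
    let _ : MeasurableSpace K := ⊤
    have h1 : Measurable c := measurable_to_countable' hc
    have h2 : Measurable fun k => (ψ k : Measure (Outcome d)) := measurable_from_top
    exact h2.comp (h1.comp measurable_fst)

/-- A forecaster that runs Unbiased-Prediction exists when the events of each round depend on the
transcript only through a countably-valued measurable statistic `k`. The weights are rounded to a
fine grid, and a near-minimizer is picked for each rounded value, so measurability of the choice is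
automatic. -/
lemma exists_isUnbiasedPrediction {ℰ κ : Type*} [Fintype ℰ] [Countable κ] {E : ℰ → Event X d}
    (hE : IsBoundedEventFamily E) (k : ∀ t, Transcript X d t → κ)
    (hk : ∀ t c, MeasurableSet (k t ⁻¹' {c})) (G : ℰ → κ → Outcome d → ℝ)
    (hG : ∀ e t h x p, E e t h x p = G e (k t h) p) (η : ℝ) {ε : ℝ} (hε : 0 < ε) (T : ℕ) :
    ∃ F : Forecaster X d, IsUnbiasedPrediction F E η ε T := by
  induction T with
  | zero =>
    refine ⟨⟨fun t => Kernel.const _ (Measure.dirac (Classical.arbitrary _)), fun t => ?_⟩, ?_⟩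
    · infer_instance
    · intro t ht; omega
  | succ T ih =>
    obtain ⟨F, hF⟩ := ih
    classical
    -- Rounding the weights to multiples of `1 / M` changes payoffs by at most `ε / 3`.
    obtain ⟨M, hM⟩ := exists_nat_gt ((Fintype.card ℰ * (d * 2)) / (ε / 3))
    have hM0 : (0 : ℝ) < M := lt_of_le_of_lt (by positivity) hM
    have hMε : (Fintype.card ℰ * (d * 2)) * (1 / (M : ℝ)) ≤ ε / 3 := by
      rw [div_lt_iff₀ (by positivity)] at hM
      rw [mul_one_div, div_le_iff₀ hM0]
      linarith
    let K := (ℰ → Fin d → ℤˣ → ℤ) × κ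
    let c : Transcript X d T → K := fun h => (fun e i σ => ⌊M * weight F E η h e i σ⌋, k T h)
    have hc : ∀ z, MeasurableSet (c ⁻¹' {z}) := by
      intro z
      have hz : c ⁻¹' {z} = (⋂ e, ⋂ i, ⋂ σ, {h | ⌊M * weight F E η h e i σ⌋ = z.1 e i σ}) ∩
          k T ⁻¹' {z.2} := by
        ext h
        rw [Set.mem_preimage, Set.mem_singleton_iff, Prod.ext_iff]
        simp [c, funext_iff]
      rw [hz]
      refine MeasurableSet.inter (MeasurableSet.iInter fun e => MeasurableSet.iInter fun i =>
        MeasurableSet.iInter fun σ => ?_) (hk T z.2)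
      exact (Int.measurable_floor.comp ((hE.measurable_weight F η T e i σ).const_mul _))
        (measurableSet_singleton _)
    have hGe : ∀ (h : Transcript X d T) (x : X),
        (fun e => E e T h x) = fun e => G e (k T h) := by
      intro h x; ext e p; exact hG e T h x p
    have hopt : ∀ z : K, ∃ ψ : ProbabilityMeasure (Outcome d),
        ∀ h (x : X), c h = z → ∀ ψ' : ProbabilityMeasure (Outcome d),
          worstCaseBias F E η h x ψ ≤ worstCaseBias F E η h x ψ' + ε := by
      intro z
      by_cases hz : ∃ (h : Transcript X d T) (_ : X), c h = z
      · obtain ⟨h₀, x₀, rfl⟩ := hz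
        obtain ⟨ψ, hψ⟩ := exists_worstPayoff_le_add (fun e p => hE.abs_le_one e T h₀ x₀ p)
          (weight F E η h₀) (show 0 < ε / 3 by linarith)
        refine ⟨ψ, fun h x hh ψ' => ?_⟩
        have hkk : k T h = k T h₀ := congrArg Prod.snd hh
        have hfl : ∀ e i σ, |weight F E η h e i σ - weight F E η h₀ e i σ| ≤ 1 / M := by
          intro e i σ
          have h1 : ⌊M * weight F E η h e i σ⌋ = ⌊M * weight F E η h₀ e i σ⌋ :=
            congrFun (congrFun (congrFun (congrArg Prod.fst hh) e) i) σ
          have h2 := Int.abs_sub_lt_one_of_floor_eq_floor h1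
          rw [← mul_sub, abs_mul, abs_of_pos hM0] at h2
          rw [le_div_iff₀ hM0]
          linarith
        have hsum : ∑ e, ∑ i, ∑ σ, |weight F E η h e i σ - weight F E η h₀ e i σ| ≤ ε / 3 := by
          calc _ ≤ ∑ _e : ℰ, ∑ _i : Fin d, ∑ _σ : ℤˣ, (1 / (M : ℝ)) :=
                Finset.sum_le_sum fun e _ => Finset.sum_le_sum fun i _ =>
                  Finset.sum_le_sum fun σ _ => hfl e i σ
            _ = (Fintype.card ℰ * (d * 2)) * (1 / (M : ℝ)) := by
                simp only [Finset.sum_const, Finset.card_univ, nsmul_eq_mul, Fintype.card_fin,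
                  Fintype.card_units_int]
                push_cast; ring
            _ ≤ ε / 3 := hMε
        have hsame : (fun e => E e T h x) = fun e => E e T h₀ x₀ := by rw [hGe, hGe, hkk]
        have hGm : ∀ e, Measurable (E e T h₀ x₀) := fun e => hE.measurable_apply e h₀ x₀
        have hGb : ∀ e p, |E e T h₀ x₀ p| ≤ 1 := fun e p => hE.abs_le_one e T h₀ x₀ p
        rw [worstCaseBias_eq, worstCaseBias_eq, hsame]
        have e1 := worstPayoff_le_add hGm hGb (weight F E η h) (weight F E η h₀) ψ
        have e2 := worstPayoff_le_add hGm hGb (weight F E η h₀) (weight F E η h) ψ'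
        have e3 := hψ ψ'
        simp_rw [abs_sub_comm (weight F E η h₀ _ _ _)] at e2
        linarith
      · exact ⟨⟨Measure.dirac (Classical.arbitrary _), inferInstance⟩,
          fun h x hh => absurd ⟨h, x, hh⟩ hz⟩
    choose ψ hψ using hopt
    let F' : Forecaster X d :=
      ⟨Function.update F.pred T (codedKernel c hc ψ), fun t => by
        by_cases ht : t = T
        · subst ht
          rw [Function.update_self]
          exact ⟨fun z => (ψ (c z.1)).2⟩
        · rw [Function.update_of_ne ht]
          exact F.markov_pred t⟩
    have hw : ∀ t ≤ T, ∀ h : Transcript X d t, weight F' E η h = weight F E η h :=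
      fun t ht h => weight_congr
        (fun s hs => Function.update_of_ne (by omega : s ≠ T) _ _) E η h
    refine ⟨F', fun t ht h x ψ' => ?_⟩
    have htT : t ≤ T := by omega
    simp only [worstCaseBias_eq, hw t htT]
    simp only [← worstCaseBias_eq]
    by_cases h' : t = T
    · subst h'
      have : F'.pred t (h, x) = ψ (c h) := by
        simp only [F', Function.update_self]; rfl
      rw [this]
      exact hψ _ h x rfl ψ'
    · have : F'.pred t = F.pred t := Function.update_of_ne h' _ _
      rw [this]
      exact hF t (by omega) h x ψ'

end Existence

/-! ### Decision events -/

section DecisionEvents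

variable {X A ι : Type*} [MeasurableSpace X] [Fintype A] {d J : ℕ}

lemma measurableSet_mem_candidate (g : Agent A d J) (t : ℕ) (a : A) :
    MeasurableSet {h : Transcript X d t | a ∈ candidate g t h} := by
  simp only [mem_candidate, Set.ofPred_forall]
  refine MeasurableSet.iInter fun s => MeasurableSet.iInter fun j => ?_
  exact measurableSet_le ((g.measurable_constraint j a).comp (measurable_outcome s))
    measurable_const

lemma measurableSet_candidate_eq (g : Agent A d J) (t : ℕ) (C : Finset A) :
    MeasurableSet {h : Transcript X d t | candidate g t h = C} := by
  simp only [Finset.ext_iff, Set.ofPred_forall]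
  refine MeasurableSet.iInter fun a => ?_
  by_cases ha : a ∈ C
  · simpa [ha] using measurableSet_mem_candidate (X := X) g t a
  · simpa only [ha, iff_false, Set.compl_ofPred] using
      (measurableSet_mem_candidate (X := X) g t a).compl

lemma isBoundedEventFamily_decisionEvent (N : ι → Agent A d J)
    {r : ι → Finset A → Outcome d → A}
    (hr : ∀ i, IsConstrainedBestResponse (N i).utility (r i)) :
    IsBoundedEventFamily (X := X) (decisionEvent N r) where
  measurable e t := by
    classical
    have hm : MeasurableSet {z : (Transcript X d t × X) × Outcome d |
        r e.1 (candidate (N e.1) t z.1.1) z.2 = e.2} := by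
      have : {z : (Transcript X d t × X) × Outcome d |
          r e.1 (candidate (N e.1) t z.1.1) z.2 = e.2} =
          ⋃ C : Finset A, ({h : Transcript X d t | candidate (N e.1) t h = C} ×ˢ Set.univ) ×ˢ
            {p | r e.1 C p = e.2} := by
        ext z; simp
      rw [this]
      exact MeasurableSet.iUnion fun C =>
        ((measurableSet_candidate_eq _ t C).prod .univ).prod ((hr e.1).2 C e.2)
    unfold decisionEvent
    convert! Measurable.ite hm (measurable_const (a := (1 : ℝ))) (measurable_const (a := (0 : ℝ)))
  abs_le_one e t h x p := by
    unfold decisionEvent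
    split_ifs <;> simp

open Classical in
lemma exists_isDecisionCalibrationRealization [Fintype ι] (N : ι → Agent A d J)
    {r : ι → Finset A → Outcome d → A}
    (hr : ∀ i, IsConstrainedBestResponse (N i).utility (r i)) (η : ℝ) {ε : ℝ} (hε : 0 < ε)
    (T : ℕ) : ∃ F : Forecaster X d, IsDecisionCalibrationRealization F N r η ε T := by
  refine exists_isUnbiasedPrediction (isBoundedEventFamily_decisionEvent N hr)
    (fun t h i => candidate (N i) t h) (fun t c => ?_)
    (fun e C p => if r e.1 (C e.1) p = e.2 then 1 else 0) (fun e t h x p => rfl) η hε T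
  have : (fun (h : Transcript X d t) i => candidate (N i) t h) ⁻¹' {c} =
      ⋂ i, {h | candidate (N i) t h = c i} := by
    ext h; simp [funext_iff]
  rw [this]
  exact MeasurableSet.iInter fun i => measurableSet_candidate_eq _ t _

end DecisionEvents

/-! ### Exponential weights -/

/-- **Hoeffding's lemma** for a random variable on a finite set with values in `[-1,1]`. -/
lemma sum_mul_exp_le {α : Type*} [Fintype α] {q g : α → ℝ} (hq : ∀ j, 0 ≤ q j)
    (hq1 : ∑ j, q j = 1) (hg : ∀ j, |g j| ≤ 1) (l : ℝ) :
    ∑ j, q j * Real.exp (l * g j) ≤ Real.exp (l * ∑ j, q j * g j + l ^ 2 / 2) := by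
  let _ : MeasurableSpace α := ⊤
  set μ : Measure α := ∑ j, ENNReal.ofReal (q j) • Measure.dirac j with hμ
  have hint : ∀ f : α → ℝ, ∫ j, f j ∂μ = ∑ j, q j * f j := by
    intro f
    rw [hμ, integral_finsetSum_measure
      fun j _ => (integrable_dirac (by simp)).smul_measure ENNReal.ofReal_ne_top]
    simp [integral_smul_measure, ENNReal.toReal_ofReal, hq]
  have hprob : IsProbabilityMeasure μ := ⟨by
    simp [hμ, ← ENNReal.ofReal_sum_of_nonneg fun j _ => hq j, hq1]⟩
  have h := (hasSubgaussianMGF_of_mem_Icc (μ := μ) (X := g) (a := -1) (b := 1)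
    measurable_from_top.aemeasurable (.of_forall fun j => abs_le.1 (hg j))).mgf_le l
  rw [mgf, hint, hint] at h
  have h2 : ∑ j, q j * Real.exp (l * g j) =
      Real.exp (l * ∑ j, q j * g j) *
        ∑ j, q j * Real.exp (l * (g j - ∑ j, q j * g j)) := by
    rw [Finset.mul_sum]
    refine Finset.sum_congr rfl fun j _ => ?_
    rw [mul_left_comm, ← Real.exp_add]
    ring_nf
  rw [h2, Real.exp_add]
  refine mul_le_mul_of_nonneg_left (h.trans (Real.exp_le_exp.2 ?_)) (Real.exp_pos _).le
  norm_num

section ExpWeights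

variable {X : Type*} [MeasurableSpace X] {d : ℕ} {ℰ : Type*} {E : ℰ → Event X d}

lemma expWeight_succ (F : Forecaster X d) (E : ℰ → Event X d) (η : ℝ) {t : ℕ}
    (h : Transcript X d (t + 1)) (e : ℰ) (i : Fin d) (σ : ℤˣ) :
    expWeight F E η h e i σ = expWeight F E η (before h (Fin.last t)) e i σ *
      Real.exp (η / 2 * (((σ : ℤ) : ℝ) * expectedBias F (E e) h (Fin.last t) i)) := by
  unfold expWeight
  rw [Fin.sum_univ_castSucc, ← Real.exp_add, ← mul_add]
  rfl

variable [Fintype ℰ]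

lemma integral_payoff {G : ℰ → Outcome d → ℝ} (hGm : ∀ e, Measurable (G e))
    (hG : ∀ e p, |G e p| ≤ 1) (q : ℰ → Fin d → ℤˣ → ℝ) (y : Outcome d)
    (ψ : Measure (Outcome d)) [IsProbabilityMeasure ψ] :
    ∫ p, payoff G q p y ∂ψ = ∑ e, ∑ i, ∑ σ : ℤˣ, q e i σ *
      (((σ : ℤ) : ℝ) * ∫ p, G e p * ((p : Fin d → ℝ) i - (y : Fin d → ℝ) i) ∂ψ) := by
  have hint : ∀ e i (σ : ℤˣ), Integrable (fun p => q e i σ * ((σ : ℤ) : ℝ) * G e p *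
      ((p : Fin d → ℝ) i - (y : Fin d → ℝ) i)) ψ := by
    intro e i σ
    refine .of_bound (C := |q e i σ|) (((hGm e).const_mul _).mul
      ((measurable_coord i).sub_const _)).aestronglyMeasurable (.of_forall fun p => ?_)
    rw [Real.norm_eq_abs, abs_mul, abs_mul, abs_mul, abs_intUnit, mul_one, mul_assoc]
    exact mul_le_of_le_one_right (abs_nonneg _)
      (mul_le_one₀ (hG e p) (abs_nonneg _) (abs_coord_sub_le p y i))
  unfold payoff
  rw [integral_finsetSum _ fun e _ => integrable_finsetSum _ fun i _ =>
    integrable_finsetSum _ fun σ _ => hint e i σ]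
  refine Finset.sum_congr rfl fun e _ => ?_
  rw [integral_finsetSum _ fun i _ => integrable_finsetSum _ fun σ _ => hint e i σ]
  refine Finset.sum_congr rfl fun i _ => ?_
  rw [integral_finsetSum _ fun σ _ => hint e i σ]
  refine Finset.sum_congr rfl fun σ _ => ?_
  rw [← mul_assoc, ← integral_const_mul]
  simp only [mul_assoc]

/-- In every round, whatever the outcome, the weighted expected bias is at most the optimization
error, since the value of the min-max problem is at most `0`. -/
lemma IsUnbiasedPrediction.sum_weight_mul_expectedBias_le (hE : IsBoundedEventFamily E)
    {F : Forecaster X d} {η ε : ℝ} {T t : ℕ} (hF : IsUnbiasedPrediction F E η ε T) (ht : t < T)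
    (h : Transcript X d (t + 1)) :
    ∑ e, ∑ i, ∑ σ : ℤˣ, weight F E η (before h (Fin.last t)) e i σ *
      (((σ : ℤ) : ℝ) * expectedBias F (E e) h (Fin.last t) i) ≤ ε := by
  have := F.markov_pred t
  set h' : Transcript X d t := before h (Fin.last t) with hh'
  set x := feature h (Fin.last t) with hx
  have hGm : ∀ e, Measurable (E e t h' x) := fun e => hE.measurable_apply e h' x
  have hGb : ∀ e p, |E e t h' x p| ≤ 1 := fun e p => hE.abs_le_one e t h' x p
  have h1 := integral_payoff hGm hGb (weight F E η h') (outcome h (Fin.last t))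
    (F.pred t (h', x))
  have h2 := le_worstPayoff hGb (weight F E η h') (outcome h (Fin.last t)) (F.pred t (h', x))
  have h3 : worstPayoff (fun e => E e t h' x) (weight F E η h') (F.pred t (h', x)) ≤ ε := by
    refine le_of_forall_pos_le_add fun ε' hε' => ?_
    obtain ⟨ψ, hψ⟩ := exists_worstPayoff_le hGm hGb (weight F E η h') hε'
    have := hF t ht h' x ψ
    rw [worstCaseBias_eq, worstCaseBias_eq] at this
    linarith
  rw [h1] at h2
  exact h2.trans h3

lemma sum_expWeight_pos [Nonempty ℰ] (hd : 0 < d) (F : Forecaster X d) (E : ℰ → Event X d) (η : ℝ)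
    {t : ℕ} (h : Transcript X d t) : 0 < ∑ e, ∑ i, ∑ σ, expWeight F E η h e i σ := by
  have : Nonempty (Fin d) := ⟨⟨0, hd⟩⟩
  exact Finset.sum_pos (fun e _ => Finset.sum_pos (fun i _ => Finset.sum_pos
    (fun σ _ => Real.exp_pos _) Finset.univ_nonempty) Finset.univ_nonempty) Finset.univ_nonempty

/-- The total exponential weight grows by at most a factor `exp (η / 2 * ε + (η / 2) ^ 2 / 2)` per
round. -/
lemma IsUnbiasedPrediction.sum_expWeight_le [Nonempty ℰ] (hd : 0 < d)
    (hE : IsBoundedEventFamily E) {F : Forecaster X d} {η ε : ℝ} (hη : 0 ≤ η) {T : ℕ}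
    (hF : IsUnbiasedPrediction F E η ε T) : ∀ t ≤ T, ∀ h : Transcript X d t,
      ∑ e, ∑ i, ∑ σ, expWeight F E η h e i σ ≤
        (2 * d * Fintype.card ℰ) * Real.exp (t * (η / 2 * ε + (η / 2) ^ 2 / 2)) := by
  intro t
  induction t with
  | zero =>
    intro _ h
    simp only [expWeight, Finset.univ_eq_empty, Finset.sum_empty, mul_zero, Real.exp_zero,
      Finset.sum_const, Finset.card_univ, nsmul_eq_mul, Fintype.card_fin,
      Fintype.card_units_int, CharP.cast_eq_zero, zero_mul, mul_one]
    push_cast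
    exact le_of_eq (by ring)
  | succ t ih =>
    intro ht h
    set h' : Transcript X d t := before h (Fin.last t) with hh'
    set S := ∑ e, ∑ i, ∑ σ, expWeight F E η h' e i σ with hS
    have hS0 : 0 < S := sum_expWeight_pos hd F E η h'
    have hw : ∀ e i σ, expWeight F E η h' e i σ = S * weight F E η h' e i σ := by
      intro e i σ
      unfold weight
      rw [← hS, mul_div_cancel₀ _ hS0.ne']
    have hwpos : ∀ e i σ, 0 ≤ weight F E η h' e i σ := fun e i σ =>
      div_nonneg (Real.exp_pos _).le hS0.le
    have hw1 : ∑ e, ∑ i, ∑ σ, weight F E η h' e i σ = 1 := by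
      have := hS
      simp_rw [hw, ← Finset.mul_sum] at this
      exact (mul_eq_left₀ hS0.ne').1 this.symm
    have hH := sum_mul_exp_le (α := ℰ × Fin d × ℤˣ)
      (q := fun j => weight F E η h' j.1 j.2.1 j.2.2)
      (g := fun j => ((j.2.2 : ℤ) : ℝ) * expectedBias F (E j.1) h (Fin.last t) j.2.1)
      (fun j => hwpos _ _ _) (by simpa only [Fintype.sum_prod_type] using hw1)
      (fun j => by
        rw [abs_mul, abs_intUnit, one_mul]
        exact hE.abs_expectedBias_le F j.1 h _ _) (η / 2)
    simp only [Fintype.sum_prod_type] at hH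
    have hstep := hF.sum_weight_mul_expectedBias_le hE (show t < T by omega) h
    calc _ = S * ∑ e, ∑ i, ∑ σ : ℤˣ, weight F E η h' e i σ *
          Real.exp (η / 2 * (((σ : ℤ) : ℝ) * expectedBias F (E e) h (Fin.last t) i)) := by
          simp_rw [Finset.mul_sum, expWeight_succ, ← hh', hw, mul_assoc]
      _ ≤ S * Real.exp (η / 2 * ε + (η / 2) ^ 2 / 2) := by
          refine mul_le_mul_of_nonneg_left (hH.trans (Real.exp_le_exp.2 ?_)) hS0.le
          gcongr
      _ ≤ (2 * d * Fintype.card ℰ) * Real.exp (t * (η / 2 * ε + (η / 2) ^ 2 / 2)) *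
          Real.exp (η / 2 * ε + (η / 2) ^ 2 / 2) :=
          mul_le_mul_of_nonneg_right (ih (by omega) h') (Real.exp_pos _).le
      _ = _ := by
          rw [mul_assoc, ← Real.exp_add]
          push_cast
          ring_nf

/-- The expected bias of Unbiased-Prediction is small on every transcript. -/
lemma IsUnbiasedPrediction.sum_expectedBias_le [Nonempty ℰ] (hd : 0 < d)
    (hE : IsBoundedEventFamily E) {F : Forecaster X d} {η ε : ℝ} (hη : 0 < η) {T : ℕ}
    (hF : IsUnbiasedPrediction F E η ε T) (h : Transcript X d T) (e : ℰ) (i : Fin d) (σ : ℤˣ) :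
    ∑ s, ((σ : ℤ) : ℝ) * expectedBias F (E e) h s i ≤
      Real.log (2 * d * Fintype.card ℰ) / (η / 2) + T * (ε + η / 4) := by
  have h1 := hF.sum_expWeight_le hd hE hη.le T le_rfl h
  have h2 : expWeight F E η h e i σ ≤ ∑ e, ∑ i, ∑ σ, expWeight F E η h e i σ := by
    have := Finset.single_le_sum (f := fun j : ℰ × Fin d × ℤˣ => expWeight F E η h j.1 j.2.1 j.2.2)
      (fun j _ => (Real.exp_pos _).le) (Finset.mem_univ (e, i, σ))
    simpa only [Fintype.sum_prod_type] using this
  have hN : (0 : ℝ) < 2 * d * Fintype.card ℰ := by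
    have : 0 < Fintype.card ℰ := Fintype.card_pos
    positivity
  have h3 := Real.log_le_log (Real.exp_pos _) (h2.trans h1)
  rw [Real.log_exp, Real.log_mul hN.ne' (Real.exp_pos _).ne', Real.log_exp] at h3
  have hη2 : 0 < η / 2 := by linarith
  have h4 : Real.log (2 * d * Fintype.card ℰ) / (η / 2) + T * (ε + η / 4) =
      (Real.log (2 * d * Fintype.card ℰ) + T * (η / 2 * ε + (η / 2) ^ 2 / 2)) / (η / 2) := by
    field_simp
    ring
  rw [h4, le_div_iff₀ hη2]
  linarith

end ExpWeights

/-! ### Concentration of the realized bias -/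

section Concentration

lemma before_snoc_last {X : Type*} {d t : ℕ} (h : Transcript X d t) (z : Round X d) :
    before (Fin.snoc (α := fun _ => Round X d) h z : Transcript X d (t + 1)) (Fin.last t) = h := by
  funext r
  exact Fin.snoc_castSucc (α := fun _ => Round X d) z h r

variable {X : Type*} [MeasurableSpace X] {d : ℕ} {ℰ : Type*} {E : ℰ → Event X d}

/-- The realized bias in coordinate `i` on the event `E` in round `s`. -/
noncomputable def realizedBias (E : Event X d) {t : ℕ} (h : Transcript X d t) (s : Fin t)
    (i : Fin d) : ℝ :=
  E s (before h s) (feature h s) (prediction h s) *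
    ((prediction h s : Fin d → ℝ) i - (outcome h s : Fin d → ℝ) i)

/-- The signed deviation of the realized bias of a round from its mean over the prediction. -/
noncomputable def biasDeviation (F : Forecaster X d) (E : Event X d) (i : Fin d) (σ : ℤˣ) {t : ℕ}
    (h : Transcript X d t) (s : Fin t) : ℝ :=
  ((σ : ℤ) : ℝ) * (realizedBias E h s i - expectedBias F E h s i)

lemma IsBoundedEventFamily.measurable_biasDeviation (hE : IsBoundedEventFamily E)
    (F : Forecaster X d) (e : ℰ) (i : Fin d) (σ : ℤˣ) {t : ℕ} (s : Fin t) :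
    Measurable fun h : Transcript X d t => biasDeviation F (E e) i σ h s := by
  unfold biasDeviation realizedBias
  refine Measurable.const_mul (Measurable.sub (Measurable.mul ?_ ?_)
    (hE.measurable_expectedBias F e s i)) _
  · exact (hE.measurable e s).comp (((measurable_before s).prodMk (measurable_feature s)).prodMk
      (measurable_prediction s))
  · exact ((measurable_coord i).comp (measurable_prediction s)).sub
      ((measurable_coord i).comp (measurable_outcome s))

lemma sum_biasDeviation_snoc (F : Forecaster X d) (E : Event X d) (i : Fin d) (σ : ℤˣ) {t : ℕ}
    (h : Transcript X d t) (x : X) (p y : Outcome d) :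
    ∑ s, biasDeviation F E i σ
        (Fin.snoc (α := fun _ => Round X d) h (x, p, y) : Transcript X d (t + 1)) s =
      ∑ s, biasDeviation F E i σ h s +
        ((σ : ℤ) : ℝ) * (E t h x p * ((p : Fin d → ℝ) i - (y : Fin d → ℝ) i) -
          ∫ p, E t h x p * ((p : Fin d → ℝ) i - (y : Fin d → ℝ) i) ∂(F.pred t (h, x))) := by
  have key : ∀ H : Transcript X d (t + 1), ∑ s, biasDeviation F E i σ H s =
      ∑ s, biasDeviation F E i σ (before H (Fin.last t)) s +
        ((σ : ℤ) : ℝ) * (E t (before H (Fin.last t)) (feature H (Fin.last t))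
          (prediction H (Fin.last t)) * ((prediction H (Fin.last t) : Fin d → ℝ) i -
            (outcome H (Fin.last t) : Fin d → ℝ) i) -
          ∫ p, E t (before H (Fin.last t)) (feature H (Fin.last t)) p * ((p : Fin d → ℝ) i -
            (outcome H (Fin.last t) : Fin d → ℝ) i)
              ∂(F.pred t (before H (Fin.last t), feature H (Fin.last t)))) := by
    intro H
    rw [Fin.sum_univ_castSucc]
    rfl
  rw [key, before_snoc_last]
  simp only [feature, prediction, outcome, Fin.snoc_last]
  rfl

/-- One round of the interaction, with the prediction integrated first. -/
lemma lintegral_transcriptLaw_succ (F : Forecaster X d) (adv : Adversary X d) (t : ℕ)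
    {φ : Transcript X d (t + 1) → ENNReal} (hφ : Measurable φ) :
    ∫⁻ h, φ h ∂(transcriptLaw F adv (t + 1)) =
      ∫⁻ h, ∫⁻ x, ∫⁻ y, ∫⁻ p, φ (Fin.snoc (α := fun _ => Round X d) h (x, p, y))
        ∂(F.pred t (h, x)) ∂(adv.out t (h, x)) ∂(adv.feat t h) ∂(transcriptLaw F adv t) := by
  have := F.markov_pred t
  have := adv.markov_feat t
  have := adv.markov_out t
  have hm : Measurable fun z : Transcript X d t × Round X d =>
      φ (Fin.snoc (α := fun _ => Round X d) z.1 z.2) := hφ.comp (measurable_snoc_round t)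
  rw [transcriptLaw, lintegral_map hφ (measurable_snoc_round t), Measure.lintegral_compProd hm]
  refine lintegral_congr fun h => ?_
  have hmh := hm.comp (measurable_prodMk_left (x := h))
  simp only [Function.comp_def] at hmh
  rw [roundKernel, Kernel.lintegral_compProd _ _ _ hmh]
  refine lintegral_congr fun x => ?_
  have hmx := hmh.comp (measurable_prodMk_left (x := x))
  simp only [Function.comp_def] at hmx
  rw [Kernel.prod_apply, lintegral_prod_symm' _ hmx]

/-- Hoeffding's lemma for the deviation in a round, for a fixed outcome. -/
lemma IsBoundedEventFamily.lintegral_exp_le (hE : IsBoundedEventFamily E)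
    (e : ℰ) (i : Fin d) (σ : ℤˣ) (l : ℝ) {t : ℕ} (h : Transcript X d t) (x : X) (y : Outcome d)
    (ψ : Measure (Outcome d)) [IsProbabilityMeasure ψ] :
    ∫⁻ p, ENNReal.ofReal (Real.exp (l * (((σ : ℤ) : ℝ) *
        (E e t h x p * ((p : Fin d → ℝ) i - (y : Fin d → ℝ) i) -
          ∫ p, E e t h x p * ((p : Fin d → ℝ) i - (y : Fin d → ℝ) i) ∂ψ)))) ∂ψ ≤
      ENNReal.ofReal (Real.exp (l ^ 2 / 2)) := by
  have hs := hasSubgaussianMGF_of_mem_Icc (μ := ψ) (a := -1) (b := 1)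
    (hE.measurable_bias e h x y i).aemeasurable
    (.of_forall fun p => abs_le.1 (hE.abs_bias_le e h x p y i))
  have h1 := hs.mgf_le (l * ((σ : ℤ) : ℝ))
  have h2 := hs.integrable_exp_mul (l * ((σ : ℤ) : ℝ))
  simp only [← mul_assoc]
  rw [← ofReal_integral_eq_lintegral_ofReal h2 (.of_forall fun _ => (Real.exp_pos _).le)]
  refine ENNReal.ofReal_le_ofReal (h1.trans (Real.exp_le_exp.2 (le_of_eq ?_)))
  have : ((σ : ℤ) : ℝ) ^ 2 = 1 := by rw [← sq_abs, abs_intUnit, one_pow]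
  rw [mul_pow, this]
  norm_num

/-- The exponential moment of the total deviation. The prediction and the outcome of a round are
independent given the past, so the deviation has conditional mean `0` even given the outcome. -/
lemma IsBoundedEventFamily.lintegral_exp_sum_biasDeviation_le (hE : IsBoundedEventFamily E)
    (F : Forecaster X d) (adv : Adversary X d) (e : ℰ) (i : Fin d) (σ : ℤˣ) (l : ℝ) (t : ℕ) :
    ∫⁻ h, ENNReal.ofReal (Real.exp (l * ∑ s, biasDeviation F (E e) i σ h s))
        ∂(transcriptLaw F adv t) ≤
      ENNReal.ofReal (Real.exp (t * (l ^ 2 / 2))) := by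
  have hmeas : ∀ t, Measurable fun h : Transcript X d t =>
      ENNReal.ofReal (Real.exp (l * ∑ s, biasDeviation F (E e) i σ h s)) := fun t =>
    ENNReal.measurable_ofReal.comp (Real.measurable_exp.comp ((Finset.measurable_sum _
      fun s _ => hE.measurable_biasDeviation F e i σ s).const_mul _))
  induction t with
  | zero => simp
  | succ t ih =>
    have := F.markov_pred t
    have := adv.markov_feat t
    have := adv.markov_out t
    rw [lintegral_transcriptLaw_succ F adv t (hmeas (t + 1))]
    have hy : ∀ (h : Transcript X d t) (x : X) (y : Outcome d),
        ∫⁻ p, ENNReal.ofReal (Real.exp (l * ∑ s, biasDeviation F (E e) i σ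
          (Fin.snoc (α := fun _ => Round X d) h (x, p, y) : Transcript X d (t + 1)) s))
            ∂(F.pred t (h, x)) ≤
          ENNReal.ofReal (Real.exp (l * ∑ s, biasDeviation F (E e) i σ h s)) *
            ENNReal.ofReal (Real.exp (l ^ 2 / 2)) := by
      intro h x y
      simp_rw [sum_biasDeviation_snoc, mul_add, Real.exp_add,
        ENNReal.ofReal_mul (Real.exp_pos _).le]
      rw [lintegral_const_mul' _ _ ENNReal.ofReal_ne_top]
      gcongr
      exact hE.lintegral_exp_le e i σ l h x y (F.pred t (h, x))
    calc _ ≤ ∫⁻ h, ∫⁻ x, ∫⁻ _y,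
          ENNReal.ofReal (Real.exp (l * ∑ s, biasDeviation F (E e) i σ h s)) *
            ENNReal.ofReal (Real.exp (l ^ 2 / 2))
              ∂(adv.out t (h, x)) ∂(adv.feat t h) ∂(transcriptLaw F adv t) :=
          lintegral_mono fun h => lintegral_mono fun x => lintegral_mono fun y => hy h x y
      _ = (∫⁻ h, ENNReal.ofReal (Real.exp (l * ∑ s, biasDeviation F (E e) i σ h s))
            ∂(transcriptLaw F adv t)) * ENNReal.ofReal (Real.exp (l ^ 2 / 2)) := by
          simp only [lintegral_const, measure_univ, mul_one]
          rw [lintegral_mul_const' _ _ ENNReal.ofReal_ne_top]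
      _ ≤ ENNReal.ofReal (Real.exp (t * (l ^ 2 / 2))) * ENNReal.ofReal (Real.exp (l ^ 2 / 2)) :=
          mul_le_mul_left ih _
      _ = _ := by
          rw [← ENNReal.ofReal_mul (Real.exp_pos _).le, ← Real.exp_add]
          push_cast
          ring_nf

/-- The **Azuma–Hoeffding inequality** for the total deviation. -/
lemma IsBoundedEventFamily.measure_sum_biasDeviation_ge_le (hE : IsBoundedEventFamily E)
    (F : Forecaster X d) (adv : Adversary X d) (e : ℰ) (i : Fin d) (σ : ℤˣ) {c : ℝ} (hc : 0 ≤ c)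
    {T : ℕ} (hT : 0 < T) :
    transcriptLaw F adv T {h | c ≤ ∑ s, biasDeviation F (E e) i σ h s} ≤
      ENNReal.ofReal (Real.exp (-(c ^ 2 / (2 * T)))) := by
  have hT' : (0 : ℝ) < T := by exact_mod_cast hT
  -- `l = c / T` minimizes the Chernoff exponent `T * l ^ 2 / 2 - l * c`.
  set l := c / T with hl
  have hl0 : 0 ≤ l := by positivity
  have hmeas : Measurable fun h : Transcript X d T =>
      ENNReal.ofReal (Real.exp (l * ∑ s, biasDeviation F (E e) i σ h s)) :=
    ENNReal.measurable_ofReal.comp (Real.measurable_exp.comp ((Finset.measurable_sum _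
      fun s _ => hE.measurable_biasDeviation F e i σ s).const_mul _))
  have hM := mul_meas_ge_le_lintegral (μ := transcriptLaw F adv T) hmeas
    (ENNReal.ofReal (Real.exp (l * c)))
  have hsub : {h : Transcript X d T | c ≤ ∑ s, biasDeviation F (E e) i σ h s} ⊆
      {h | ENNReal.ofReal (Real.exp (l * c)) ≤
        ENNReal.ofReal (Real.exp (l * ∑ s, biasDeviation F (E e) i σ h s))} := fun h hh =>
    ENNReal.ofReal_le_ofReal (Real.exp_le_exp.2 (mul_le_mul_of_nonneg_left hh hl0))
  have hpos : ENNReal.ofReal (Real.exp (l * c)) ≠ 0 := by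
    simpa using Real.exp_pos _
  have h1 := (mul_le_mul_right (measure_mono hsub) (ENNReal.ofReal (Real.exp (l * c)))).trans
    (hM.trans (hE.lintegral_exp_sum_biasDeviation_le F adv e i σ l T))
  rw [mul_comm, ← ENNReal.le_div_iff_mul_le (.inl hpos) (.inl ENNReal.ofReal_ne_top),
    ← ENNReal.ofReal_div_of_pos (Real.exp_pos _), ← Real.exp_sub] at h1
  refine h1.trans (le_of_eq ?_)
  congr 2
  rw [hl]
  field_simp
  ring

variable [Fintype ℰ]

lemma intUnit_sum_realizedBias (F : Forecaster X d) (E : Event X d) {T : ℕ}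
    (h : Transcript X d T) (i : Fin d) (σ : ℤˣ) :
    ((σ : ℤ) : ℝ) * ∑ s, realizedBias E h s i =
      ∑ s, ((σ : ℤ) : ℝ) * expectedBias F E h s i + ∑ s, biasDeviation F E i σ h s := by
  rw [Finset.mul_sum, ← Finset.sum_add_distrib]
  refine Finset.sum_congr rfl fun s _ => ?_
  unfold biasDeviation
  ring

/-- With high probability, all realized biases of Unbiased-Prediction are small. -/
lemma IsUnbiasedPrediction.measure_abs_sum_realizedBias_le [Nonempty ℰ] (hd : 0 < d)
    (hE : IsBoundedEventFamily E) {F : Forecaster X d} {η ε : ℝ} (hη : 0 < η) {T : ℕ} (hT : 0 < T)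
    (hF : IsUnbiasedPrediction F E η ε T) (adv : Adversary X d) {c : ℝ} (hc : 0 ≤ c) :
    ENNReal.ofReal (1 - 2 * d * Fintype.card ℰ * Real.exp (-(c ^ 2 / (2 * T)))) ≤
      transcriptLaw F adv T {h | ∀ e i, |∑ s, realizedBias (E e) h s i| ≤
        Real.log (2 * d * Fintype.card ℰ) / (η / 2) + T * (ε + η / 4) + c} := by
  set B : Set (Transcript X d T) :=
    ⋃ e, ⋃ i, ⋃ σ, {h | c ≤ ∑ s, biasDeviation F (E e) i σ h s} with hB
  have hBm : MeasurableSet B := MeasurableSet.iUnion fun e => MeasurableSet.iUnion fun i =>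
    MeasurableSet.iUnion fun σ => measurableSet_le measurable_const
      (Finset.measurable_sum _ fun s _ => hE.measurable_biasDeviation F e i σ s)
  have hμB : transcriptLaw F adv T B ≤
      ENNReal.ofReal (2 * d * Fintype.card ℰ * Real.exp (-(c ^ 2 / (2 * T)))) := by
    calc _ ≤ ∑ e, ∑ i, ∑ σ, transcriptLaw F adv T
          {h | c ≤ ∑ s, biasDeviation F (E e) i σ h s} := by
          refine (measure_iUnion_fintype_le _ _).trans (Finset.sum_le_sum fun e _ => ?_)
          refine (measure_iUnion_fintype_le _ _).trans (Finset.sum_le_sum fun i _ => ?_)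
          exact measure_iUnion_fintype_le _ _
      _ ≤ ∑ _e : ℰ, ∑ _i : Fin d, ∑ _σ : ℤˣ,
          ENNReal.ofReal (Real.exp (-(c ^ 2 / (2 * T)))) :=
          Finset.sum_le_sum fun e _ => Finset.sum_le_sum fun i _ => Finset.sum_le_sum fun σ _ =>
            hE.measure_sum_biasDeviation_ge_le F adv e i σ hc hT
      _ = _ := by
          simp only [Finset.sum_const, Finset.card_univ, nsmul_eq_mul, Fintype.card_fin,
            Fintype.card_units_int]
          rw [ENNReal.ofReal_mul (by positivity), ENNReal.ofReal_mul (by positivity),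
            ENNReal.ofReal_mul (by positivity)]
          simp only [ENNReal.ofReal_natCast, ENNReal.ofReal_ofNat, Nat.cast_ofNat]
          ring
  have hsub : Bᶜ ⊆ {h | ∀ e i, |∑ s, realizedBias (E e) h s i| ≤
      Real.log (2 * d * Fintype.card ℰ) / (η / 2) + T * (ε + η / 4) + c} := by
    intro h hh e i
    have hdev : ∀ σ, ∑ s, biasDeviation F (E e) i σ h s < c := by
      intro σ
      by_contra! hcon
      exact hh (Set.mem_iUnion.2 ⟨e, Set.mem_iUnion.2 ⟨i, Set.mem_iUnion.2 ⟨σ, hcon⟩⟩⟩)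
    have hside : ∀ σ : ℤˣ, ((σ : ℤ) : ℝ) * ∑ s, realizedBias (E e) h s i ≤
        Real.log (2 * d * Fintype.card ℰ) / (η / 2) + T * (ε + η / 4) + c := by
      intro σ
      rw [intUnit_sum_realizedBias F]
      exact add_le_add (hF.sum_expectedBias_le hd hE hη h e i σ) (hdev σ).le
    rw [abs_le]
    have h1 := hside 1
    have h2 := hside (-1)
    simp only [Units.val_one, Int.cast_one, one_mul, Units.val_neg, Int.cast_neg, neg_mul] at h1 h2
    exact ⟨by linarith, h1⟩
  calc _ = 1 - ENNReal.ofReal (2 * d * Fintype.card ℰ * Real.exp (-(c ^ 2 / (2 * T)))) := by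
        rw [ENNReal.ofReal_sub _ (by positivity), ENNReal.ofReal_one]
    _ ≤ 1 - transcriptLaw F adv T B := tsub_le_tsub_left hμB _
    _ = transcriptLaw F adv T Bᶜ := (prob_compl_eq_one_sub hBm).symm
    _ ≤ _ := measure_mono hsub

end Concentration

/-! ### The learning rate and the regret bound -/

/-- The learning rate `2 √((log (2 d m n) + 1) / (T + 1))`, for `m` actions and `n` agents: up to
constants, the optimal rate of exponential weights over `2 d m n` experts for `T` rounds. The two
summands `1` make it positive for all values of the parameters. -/
noncomputable def learningRate (d m n T : ℕ) : ℝ :=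
  2 * √((Real.log (2 * d * (n * m : ℕ)) + 1) / (T + 1))

lemma log_expert_count_nonneg (d m n : ℕ) : 0 ≤ Real.log (2 * d * (n * m : ℕ)) := by
  have := Real.log_natCast_nonneg (2 * d * (n * m))
  push_cast at this ⊢
  exact this

lemma learningRate_pos (d m n T : ℕ) : 0 < learningRate d m n T := by
  have := log_expert_count_nonneg d m n
  unfold learningRate
  positivity

section Constants

variable {d m n T : ℕ} {δ : ℝ}

lemma two_le_confidence_arg (hd : 0 < d) (hm : 2 ≤ m) (hn : 0 < n) (hT : 0 < T) (hδ : 0 < δ)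
    (hδ1 : δ < 1) : (2 : ℝ) * d * (n * m : ℕ) ≤ 2 * (d * m * n * T / δ) ∧
      (2 : ℝ) ≤ d * m * n * T / δ := by
  have h1 : ((d * m * n : ℕ) : ℝ) ≤ (d * m * n * T : ℕ) := by
    exact_mod_cast Nat.le_mul_of_pos_right _ hT
  have h2 : (2 : ℝ) ≤ (d * m * n : ℕ) := by
    have : 2 ≤ d * m * n := by
      calc 2 ≤ m := hm
        _ ≤ d * m := Nat.le_mul_of_pos_left _ hd
        _ ≤ d * m * n := Nat.le_mul_of_pos_right _ hn
    exact_mod_cast this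
  have h3 : (d * m * n * T : ℝ) ≤ d * m * n * T / δ :=
    le_div_self (by positivity) hδ hδ1.le
  push_cast at *
  constructor <;> nlinarith

/-- The union bound over `2 d m n` deviations at the threshold `2 √(T log (d m n T / δ))`. It needs
`m ≥ 2` to absorb the factor `2`. -/
lemma failure_probability_le (hd : 0 < d) (hm : 2 ≤ m) (hn : 0 < n) (hT : 0 < T) (hδ : 0 < δ)
    (hδ1 : δ < 1) :
    2 * d * (n * m : ℕ) *
      Real.exp (-((2 * √(T * Real.log (d * m * n * T / δ))) ^ 2 / (2 * T))) ≤ δ := by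
  obtain ⟨h1, h2⟩ := two_le_confidence_arg hd hm hn hT hδ hδ1
  have hT' : (0 : ℝ) < T := by exact_mod_cast hT
  set Q : ℝ := d * m * n * T / δ with hQ
  have hQ0 : 0 < Q := by linarith
  have hl : 0 ≤ Real.log Q := Real.log_nonneg (by linarith)
  have hexp : Real.exp (-((2 * √(T * Real.log Q)) ^ 2 / (2 * T))) = (Q ^ 2)⁻¹ := by
    rw [mul_pow, Real.sq_sqrt (by positivity), Real.exp_neg]
    congr 1
    rw [show (2 : ℝ) ^ 2 * (T * Real.log Q) / (2 * T) = Real.log Q + Real.log Q by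
      field_simp; ring, Real.exp_add, Real.exp_log hQ0, sq]
  rw [hexp, ← div_eq_mul_inv, div_le_iff₀ (by positivity)]
  have h3 : δ * Q = d * m * n * T := by rw [hQ]; field_simp
  have h4 : ((d * (n * m) : ℕ) : ℝ) ≤ (d * m * n * T : ℕ) := by
    rw [show d * (n * m) = d * m * n by ring]
    exact_mod_cast Nat.le_mul_of_pos_right _ hT
  push_cast at h4 ⊢
  calc (2 : ℝ) * d * (n * m) = (d * (n * m)) * 2 := by ring
    _ ≤ (δ * Q) * Q := mul_le_mul (h3 ▸ h4) h2 zero_le_two (by positivity)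
    _ = δ * Q ^ 2 := by ring

/-- The bias bound at the learning rate `learningRate` and optimization error `1 / T`, in terms of
the rate of the regret bound. -/
lemma bias_bound_le (hd : 0 < d) (hm : 2 ≤ m) (hn : 0 < n) (hT : 0 < T) (hδ : 0 < δ)
    (hδ1 : δ < 1) :
    Real.log (2 * d * (n * m : ℕ)) / (learningRate d m n T / 2) +
      T * (1 / (T : ℝ) + learningRate d m n T / 4) +
        2 * √(T * Real.log (d * m * n * T / δ)) ≤
      9 * √(T * Real.log (d * m * n * T / δ)) := by
  obtain ⟨h1, h2⟩ := two_le_confidence_arg hd hm hn hT hδ hδ1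
  have hT1 : (1 : ℝ) ≤ T := by exact_mod_cast hT
  set Q : ℝ := d * m * n * T / δ with hQ
  set l := Real.log Q with hl
  set Λ := Real.log (2 * d * (n * m : ℕ)) with hΛ
  have hΛ0 : 0 ≤ Λ := log_expert_count_nonneg d m n
  have hl2 : 0.69 ≤ l := by
    have := Real.log_two_gt_d9
    have := Real.log_le_log (by norm_num) h2
    linarith
  have hΛl : Λ + 1 ≤ 4 * l := by
    have hpos : (0 : ℝ) < 2 * d * (n * m : ℕ) := by
      have : 0 < n * m := Nat.mul_pos hn (by omega)
      positivity
    have e1 := Real.log_le_log hpos h1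
    rw [Real.log_mul two_ne_zero (by linarith)] at e1
    have e2 := Real.log_le_log (by norm_num) h2
    linarith
  set s := √(T * l) with hs
  have hs1 : 1 ≤ 2 * s := by
    have : 1 / 2 ≤ s := Real.le_sqrt_of_sq_le (by nlinarith)
    linarith
  set v := √((Λ + 1) / (T + 1)) with hv
  have hv0 : 0 < v := by positivity
  have hv2 : v ^ 2 = (Λ + 1) / (T + 1) := Real.sq_sqrt (by positivity)
  have hv3 : v ^ 2 * (T + 1) = Λ + 1 := by rw [hv2]; field_simp
  have hη : learningRate d m n T = 2 * v := rfl
  have hvT : v * (T + 1) ≤ 3 * s := by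
    refine abs_le_of_sq_le_sq' ?_ (by positivity) |>.2
    have hs2 : s ^ 2 = T * l := Real.sq_sqrt (by positivity)
    have e1 : (v * (T + 1)) ^ 2 = (Λ + 1) * (T + 1) := by rw [← hv3]; ring
    have e2 : (Λ + 1) * (T + 1) ≤ 4 * l * (2 * T) := by gcongr; linarith
    have e3 : 0 ≤ T * l := by positivity
    rw [e1, mul_pow, hs2]
    linarith
  have hdiv : Λ / v ≤ v * (T + 1) := by
    rw [div_le_iff₀ hv0]
    nlinarith
  have hsum : T * (1 / (T : ℝ) + 2 * v / 4) = 1 + T * v / 2 := by field_simp; ring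
  rw [hη, show 2 * v / 2 = v by ring, hsum]
  nlinarith

end Constants

section HighProbability

variable {X A ι : Type*} [Fintype A] {d J : ℕ}

lemma realizedBias_decisionEvent (N : ι → Agent A d J) (r : ι → Finset A → Outcome d → A)
    (e : ι × A) {T : ℕ} (h : Transcript X d T) (s : Fin T) (i : Fin d)
    [Decidable (action (N e.1) (r e.1) h s = e.2)] :
    realizedBias (decisionEvent N r e) h s i =
      (if action (N e.1) (r e.1) h s = e.2 then 1 else 0) *
        ((prediction h s : Fin d → ℝ) i - (outcome h s : Fin d → ℝ) i) := by
  unfold realizedBias decisionEvent action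
  congr

/-- With high probability, the decisions of all agents are unbiased: on the rounds where an agent
plays a given action, predictions and outcomes agree on average in each coordinate. -/
lemma measure_decision_bias_le [MeasurableSpace X] [Fintype ι] [Nonempty ι] (hd : 0 < d) {T : ℕ}
    (hT : 0 < T) (hA : 2 ≤ Fintype.card A) (N : ι → Agent A d J) {r : ι → Finset A → Outcome d → A}
    (hr : ∀ i, IsConstrainedBestResponse (N i).utility (r i)) {F : Forecaster X d}
    (hF : IsDecisionCalibrationRealization F N r
      (learningRate d (Fintype.card A) (Fintype.card ι) T) (1 / (T : ℝ)) T)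
    (adv : Adversary X d) {δ : ℝ} (hδ : 0 < δ) (hδ1 : δ < 1) :
    ENNReal.ofReal (1 - δ) ≤ transcriptLaw F adv T {h | ∀ (e : ι × A) i,
      |∑ s, realizedBias (decisionEvent N r e) h s i| ≤
        9 * √(T * Real.log (d * Fintype.card A * Fintype.card ι * T / δ))} := by
  have hA' : Nonempty A := Fintype.card_pos_iff.1 (by omega)
  have hn : 0 < Fintype.card ι := Fintype.card_pos
  have h := IsUnbiasedPrediction.measure_abs_sum_realizedBias_le hd
    (isBoundedEventFamily_decisionEvent N hr) (learningRate_pos _ _ _ _) hT hF adv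
    (c := 2 * √(T * Real.log (d * Fintype.card A * Fintype.card ι * T / δ))) (by positivity)
  rw [Fintype.card_prod] at h
  refine (ENNReal.ofReal_le_ofReal ?_).trans (h.trans (measure_mono ?_))
  · have := failure_probability_le hd hA hn hT hδ hδ1
    linarith
  · exact fun h hh e i => (hh e i).trans (bias_bound_le hd hA hn hT hδ hδ1)

end HighProbability

end Omniprediction

theorem mainTheorem1 :
    ∃ K : ℝ, 0 < K ∧ ∃ η : ℕ → ℕ → ℕ → ℕ → ℝ, (∀ d m n T, 0 < η d m n T) ∧
      ∀ (d T J : ℕ) (_ : 0 < d) (_ : 0 < T)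
        (X : Type*) [MeasurableSpace X]
        (A : Type*) [Fintype A] [Nonempty A]
        (ι : Type*) [Fintype ι]
        (N : ι → Omniprediction.Agent A d J) (L : ℝ)
        (r : ι → Finset A → Omniprediction.Outcome d → A)
        (_ : ∀ i, (N i).LinearUtility)
        (_ : ∀ i, (N i).LipschitzUtility L)
        (_ : ∀ i, Omniprediction.IsConstrainedBestResponse (N i).utility (r i)),
        (∃ F : Omniprediction.Forecaster X d,
          Omniprediction.IsDecisionCalibrationRealization F N r
            (η d (Fintype.card A) (Fintype.card ι) T) (1 / (T : ℝ)) T) ∧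
        ∀ F : Omniprediction.Forecaster X d,
          Omniprediction.IsDecisionCalibrationRealization F N r
            (η d (Fintype.card A) (Fintype.card ι) T) (1 / (T : ℝ)) T →
          ∀ (adv : Omniprediction.Adversary X d) (δ : ℝ), 0 < δ → δ < 1 →
            ENNReal.ofReal (1 - δ) ≤
              Omniprediction.transcriptLaw F adv T
                {h | ∀ i, (Omniprediction.benchmark (N i) h).Nonempty →
                  Omniprediction.swapRegret (N i).utility (Omniprediction.benchmark (N i) h)
                      (Omniprediction.action (N i) (r i) h) (Omniprediction.outcome h) ≤
                    K * (L * Fintype.card A *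
                      √(T * Real.log (d * Fintype.card A * Fintype.card ι * T / δ))) ∧
                  Omniprediction.externalRegret (N i).utility (Omniprediction.benchmark (N i) h)
                      (Omniprediction.action (N i) (r i) h) (Omniprediction.outcome h) ≤
                    K * (L * Fintype.card A *
                      √(T * Real.log (d * Fintype.card A * Fintype.card ι * T / δ)))} := by

  classical
  refine ⟨18, by norm_num, Omniprediction.learningRate, Omniprediction.learningRate_pos, ?_⟩
  intro d T J hd hT X _ A _ _ ι _ N L r hlin hlip hr
  refine ⟨Omniprediction.exists_isDecisionCalibrationRealization N hr _ (by positivity) T, ?_⟩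
  intro F hF adv δ hδ hδ1
  set s := √(T * Real.log (d * Fintype.card A * Fintype.card ι * T / δ)) with hs
  -- The event in question contains every event on which all swaps gain at most the bound.
  suffices H : ∃ S : Set (Omniprediction.Transcript X d T),
      ENNReal.ofReal (1 - δ) ≤ Omniprediction.transcriptLaw F adv T S ∧
      ∀ h ∈ S, ∀ i, ∀ φ : A → A, (∀ a, φ a ∈ Omniprediction.benchmark (N i) h) →
        ∑ t, ((N i).utility (φ (Omniprediction.action (N i) (r i) h t))
            (Omniprediction.outcome h t) -
          (N i).utility (Omniprediction.action (N i) (r i) h t) (Omniprediction.outcome h t)) ≤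
          18 * (L * Fintype.card A * s) by
    obtain ⟨S, hS, hreg⟩ := H
    refine hS.trans (MeasureTheory.measure_mono fun h hh i hB => ?_)
    exact ⟨Omniprediction.swapRegret_le hB (hreg h hh i),
      Omniprediction.externalRegret_le hB (hreg h hh i)⟩
  rcases isEmpty_or_nonempty ι with hι | hι
  · refine ⟨Set.univ, ?_, fun h _ i => hι.elim i⟩
    rw [MeasureTheory.measure_univ]
    exact ENNReal.ofReal_le_one.2 (by linarith)
  rcases Nat.lt_or_ge 1 (Fintype.card A) with hA | hA
  · refine ⟨_, Omniprediction.measure_decision_bias_le hd hT hA N hr hF adv hδ hδ1,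
      fun h hh i φ hφ => ?_⟩
    have hreg := Omniprediction.sum_utility_swap_le (hlin i) (hlip i) hd (hr i) h
      (β := 9 * s) (fun a j => by
        have := hh (i, a) j
        simpa only [Omniprediction.realizedBias_decisionEvent] using this) φ hφ
    exact hreg.trans (le_of_eq (by ring))
  · -- With a single action, there is no regret. This case is separate because the logarithm in the
    -- bound can then be arbitrarily close to `0`.
    have : Subsingleton A := Fintype.card_le_one_iff_subsingleton.1 hA
    refine ⟨Set.univ, ?_, fun h _ i φ _ => ?_⟩
    · rw [MeasureTheory.measure_univ]
      exact ENNReal.ofReal_le_one.2 (by linarith)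
    · have hL := (hlin i).lipschitz_nonneg (hlip i) hd (Classical.arbitrary A)
      refine le_trans (Finset.sum_nonpos fun t _ => ?_)
        (by positivity : 0 ≤ 18 * (L * Fintype.card A * s))
      rw [Subsingleton.elim (φ _) (Omniprediction.action (N i) (r i) h t), sub_self]
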